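/- Consider the following generalized group-buying allocation problem. An instance consists of $M$ classes of items, where class $i$ has a lower bound $l_i\in\mathbb Z^+$, an upper bound $u_i\in\mathbb Z^+$ and a nonnegative rational profit $p_i$ per item, and of a target vector $N=(N_1,\dots,N_K)$ of nonnegative integers, which need not be monotone. An allocation is a vector $x=(x_1,\dots,x_M)$ of nonnegative integers. It is feasible if 1. for every $i$, either $x_i=0$ or $l_i\le x_i\le u_i$; and 2. for every $r\ge 1$, $\sum_{t=1}^{r} x_{[t]}\le\sum_{t=1}^{r} N_t$, where $x_{[1]}\ge x_{[2]}\ge\cdots\ge x_{[M]}$ are the entries of $x$ in nonincreasing order, $x_{[t]}=0$ for $t>M$, and $N_t=0$ for $t>K$ (the entries of $N$ are taken in their given order). Let $\mathcal{OPT}$ be the maximum of $\sum_{i=1}^M p_i x_i$ over all feasible allocations $x$. Theorem. For every constant $\epsilon>0$ there is an algorithm that, given any instance, computes a feasible allocation $x$ with $$\sum_{i=1}^M p_i x_i\ \ge\ \Bigl(\tfrac12-\epsilon\Bigr)\,\mathcal{OPT}$$ in time polynomial in the bit length of the instance, where the polynomial may depend on $\epsilon$. (Time is the logarithmic cost on a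 random access machine.) -/

import Mathlib

/-!  # The group-buying allocation problem with an arbitrary target vector -/

/-- An instance: `M` classes of items, class `i` having a lower bound `lower i`, an upper bound
`upper i` (positive integers) and a profit `profit i` per item, and a target vector
`N₁, …, N_K` of nonnegative integers, on whose order nothing is assumed. -/
structure GAPInstance where
  M : ℕ
  K : ℕ
  lower : Fin M → ℕ
  upper : Fin M → ℕ
  profit : Fin M → ℚ≥0
  target : Fin K → ℕ
  lower_pos : ∀ i, 0 < lower i
  upper_pos : ∀ i, 0 < upper i

namespace GAPInstance

/-- `x_[1] + ⋯ + x_[r]`, the sum of the `r` largest entries of `x`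
(of all entries if there are fewer than `r`, i.e. `x` is padded with zeros). -/
def topSum {n : ℕ} (x : Fin n → ℕ) (r : ℕ) : ℕ :=
  (((List.ofFn x).insertionSort (fun a b => b ≤ a)).take r).sum

/-- `N_1 + ⋯ + N_r`, in the given order, where `N_j = 0` for `j > K`. -/
def targetSum (I : GAPInstance) (r : ℕ) : ℕ :=
  ((List.ofFn I.target).take r).sum

/-- Feasible allocations: every class is unused or used within its bounds, and the sum of the `r`
largest entries is at most `N_1 + ⋯ + N_r` for all `r`. -/
def Feasible (I : GAPInstance) (x : Fin I.M → ℕ) : Prop :=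
  (∀ i, x i = 0 ∨ (I.lower i ≤ x i ∧ x i ≤ I.upper i)) ∧
    ∀ r : ℕ, topSum x r ≤ I.targetSum r

/-- The total profit of an allocation. -/
def totalProfit (I : GAPInstance) (x : Fin I.M → ℕ) : ℚ≥0 :=
  ∑ i, I.profit i * (x i : ℚ≥0)

end GAPInstance

/-!  # Random access machine with logarithmic cost

Programs are structured programs over a memory of natural numbers, with the operations
`+`, truncated `-`, `*` and integer division, and with indirect addressing. The memory is split
into banks; a program names the banks it uses by constants, and computes the addresses
inside a bank. Each operation is charged one plus the bit lengths of the numbers it handles. -/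

namespace RAM

/-- `s b a` is the content of the cell with address `a` in bank `b`. -/
abbrev Memory := ℕ → ℕ → ℕ

inductive Expr : Type
  | const (n : ℕ) : Expr
  | read (bank : ℕ) (address : Expr) : Expr
  | add (e f : Expr) : Expr
  | sub (e f : Expr) : Expr
  | mul (e f : Expr) : Expr
  | div (e f : Expr) : Expr

/-- The value of an expression (`-` is truncated at `0`, and division by `0` gives `0`). -/
def Expr.eval (s : Memory) : Expr → ℕ
  | const n => n
  | read b a => s b (a.eval s)
  | add e f => e.eval s + f.eval s
  | sub e f => e.eval s - f.eval s
  | mul e f => e.eval s * f.eval s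
  | div e f => e.eval s / f.eval s

/-- The logarithmic cost of evaluating an expression (`Nat.size` is the bit length). -/
def Expr.cost (s : Memory) : Expr → ℕ
  | const n => 1 + n.size
  | read b a => a.cost s + (1 + (a.eval s).size + (s b (a.eval s)).size)
  | add e f => e.cost s + f.cost s + (1 + (e.eval s).size + (f.eval s).size)
  | sub e f => e.cost s + f.cost s + (1 + (e.eval s).size + (f.eval s).size)
  | mul e f => e.cost s + f.cost s + (1 + (e.eval s).size + (f.eval s).size)
  | div e f => e.cost s + f.cost s + (1 + (e.eval s).size + (f.eval s).size)

inductive Program : Type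
  | skip : Program
  | write (bank : ℕ) (address value : Expr) : Program
  | seq (p q : Program) : Program
  | branch (test : Expr) (p q : Program) : Program
  | loop (test : Expr) (p : Program) : Program

/-- Memory `s` with the content of cell `a` of bank `b` replaced by `v`. -/
def Memory.set (s : Memory) (b a v : ℕ) : Memory :=
  fun b' a' => if b' = b ∧ a' = a then v else s b' a'

/-- `Exec p s t s'`: the program `p`, started on the memory `s`, halts with the memory `s'` after
a computation of total cost `t`. A test succeeds if its value is not `0`. -/
inductive Exec : Program → Memory → ℕ → Memory → Prop
  | skip (s : Memory) : Exec .skip s 1 s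
  | write (s : Memory) (b : ℕ) (a v : Expr) :
      Exec (.write b a v) s
        (a.cost s + v.cost s + (1 + (a.eval s).size + (v.eval s).size))
        (s.set b (a.eval s) (v.eval s))
  | seq {p q : Program} {s s₁ s₂ : Memory} {t₁ t₂ : ℕ} :
      Exec p s t₁ s₁ → Exec q s₁ t₂ s₂ → Exec (.seq p q) s (t₁ + t₂) s₂
  | branch_true {e : Expr} {p q : Program} {s s₁ : Memory} {t : ℕ} :
      e.eval s ≠ 0 → Exec p s t s₁ → Exec (.branch e p q) s (1 + e.cost s + t) s₁
  | branch_false {e : Expr} {p q : Program} {s s₁ : Memory} {t : ℕ} :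
      e.eval s = 0 → Exec q s t s₁ → Exec (.branch e p q) s (1 + e.cost s + t) s₁
  | loop_done {e : Expr} {p : Program} {s : Memory} :
      e.eval s = 0 → Exec (.loop e p) s (1 + e.cost s) s
  | loop_step {e : Expr} {p : Program} {s s₁ s₂ : Memory} {t₁ t₂ : ℕ} :
      e.eval s ≠ 0 → Exec p s t₁ s₁ → Exec (.loop e p) s₁ t₂ s₂ →
        Exec (.loop e p) s (1 + e.cost s + t₁ + t₂) s₂

end RAM

namespace GAPInstance

/-- The input, one list of numbers for each of the memory banks `0, …, 5`. Profits are given as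
reduced fractions. -/
def input (I : GAPInstance) : ℕ → List ℕ
  | 0 => [I.M, I.K]
  | 1 => List.ofFn I.lower
  | 2 => List.ofFn I.upper
  | 3 => List.ofFn fun i => (I.profit i).num
  | 4 => List.ofFn fun i => (I.profit i).den
  | 5 => List.ofFn I.target
  | _ => []

/-- The initial memory: the input, and `0` in all other cells. -/
def initialMemory (I : GAPInstance) : RAM.Memory :=
  fun b a => (I.input b).getD a 0

/-- The length of the input: each number counts one plus its bit length. -/
def inputSize (I : GAPInstance) : ℕ :=
  ∑ b ∈ Finset.range 6, ((I.input b).map fun n => 1 + n.size).sum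

/-- The allocation that a final memory stands for: `x_i` is in the `i`-th cell of bank `6`. -/
def output (I : GAPInstance) (s : RAM.Memory) : Fin I.M → ℕ :=
  fun i => s 6 i

/-- The program `P` is a polynomial-time algorithm that outputs, for every instance, a feasible
allocation of profit at least `ρ` times that of every feasible allocation, hence at least `ρ` times
the optimum. -/
def IsPolyTimeApproximation (ρ : ℝ) (P : RAM.Program) : Prop :=
  ∃ q : Polynomial ℕ, ∀ I : GAPInstance, ∃ (t : ℕ) (s : RAM.Memory),
    RAM.Exec P I.initialMemory t s ∧ t ≤ q.eval I.inputSize ∧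
      I.Feasible (I.output s) ∧
      ∀ y : Fin I.M → ℕ, I.Feasible y →
        ρ * (I.totalProfit y : ℝ) ≤ (I.totalProfit (I.output s) : ℝ)

end GAPInstance

/-!
# A polynomial-time approximation algorithm for the group-buying allocation problem

The condition on the sums of the largest entries says that the sum of an allocation `z` over every
set of `r` classes is at most `N_1 + ⋯ + N_r` (`sum_le_topSum`, `exists_topSum_eq`,
`feasible_unsort_iff`). Number the classes in the order of nonincreasing profit per item. If `i`
precedes `j`, both classes are used and `z i < z j`, then moving a unit from `j` to `i` keeps these
conditions and does not decrease the profit (`Feas.transfer`). Hence, in an optimal allocation that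
favours the first classes, such a unit is not movable: `z i` is at the upper bound of its class or
`z j` at the lower bound of its class (`exists_optimal`). It follows that the used classes have the
sizes `max (lo i) (min (up i) (h i))` for a nonincreasing function `h` of the position. The values
of `h` are rounded down to a short list of sizes `v 0 > v 1 > ⋯ > 0`, which contains all bounds of
classes and in which each size is at least half of the one before, up to integer division. This
loses at most a factor `2` (`exists_threshold`).

Such threshold allocations are found by a dynamic program (`SortedInstance.best`) that adds entries
in the order of nonincreasing size. In this order only the new total has to be compared with
`N_1 + ⋯ + N_r` when the `r`-th entry is added (`Feas.update`). While the size decreases, the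
number `a` of positions at which `h` is at least the current size grows. A class can be added when
the threshold `a` passes it, or after that at its upper bound, or before that at its lower bound,
and these options exclude each other (`Sound.eq_zero`). So it suffices to remember, for each
threshold `a`, number `r` of entries and profit `p`, an allocation with the least total
(`best_sound`, `Threshold.exists_best_ne_zero`). To have few values of `p`, profits are rounded down
to multiples of `V / (M E)`, where `V` is the largest profit of a single class and `E > 1 / ε`; this
loses at most `V / E`, and `V` is at most the optimum
(`SortedInstance.exists_best_ne_zero_and_profit_le`).

On the machine, an allocation is encoded with its total by a single number of polynomial bit length
(`SortedInstance.code`), so that an entry of the dynamic program fills one cell, and the better of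
two entries is the larger number. The whole algorithm then is a sequence of loops, each of which
fills a table by evaluating one expression per cell. `RAM.exec_fill` gives the result and the cost
of such a loop; it remains to evaluate the expressions (`computes_table`) and to bound the lengths
of the tables and the bit lengths of their entries (`len_le_bound`, `size_table_le_bound`).
-/

/-! ### Filling a table on the random access machine -/

namespace RAM

/-- The bit length of the value of `e` is at most `e.bits` times that of the longest number in the
memory. -/
def Expr.bits : Expr → ℕ
  | const n => n.size
  | read _ _ => 1
  | add e f => e.bits + f.bits
  | sub e _ => e.bits
  | mul e f => e.bits + f.bits
  | div e _ => e.bits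

/-- The cost of evaluating `e` is at most `e.work` times the bit length of the longest number in
the memory. -/
def Expr.work : Expr → ℕ
  | const n => 1 + n.size
  | read _ a => a.work + (1 + a.bits + 1)
  | add e f => e.work + f.work + (1 + e.bits + f.bits)
  | sub e f => e.work + f.work + (1 + e.bits + f.bits)
  | mul e f => e.work + f.work + (1 + e.bits + f.bits)
  | div e f => e.work + f.work + (1 + e.bits + f.bits)

theorem size_add_le_add_size (a b : ℕ) : (a + b).size ≤ a.size + b.size := by
  rw [Nat.size_le, pow_add]
  have ha := Nat.lt_size_self a
  have hb := Nat.lt_size_self b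
  nlinarith

theorem size_mul_le_add_size (a b : ℕ) : (a * b).size ≤ a.size + b.size := by
  rw [Nat.size_le, pow_add]
  exact Nat.mul_lt_mul'' (Nat.lt_size_self a) (Nat.lt_size_self b)

theorem Expr.size_eval_le {s : Memory} {w : ℕ} (hw : 1 ≤ w) (hs : ∀ b a, (s b a).size ≤ w)
    (e : Expr) : (e.eval s).size ≤ e.bits * w := by
  induction e with
  | const n => exact Nat.le_mul_of_pos_right _ hw
  | read b a _ => simpa [eval, bits] using hs b _
  | add e f he hf =>
    simp only [eval, bits, add_mul]
    exact (size_add_le_add_size _ _).trans (by omega)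
  | sub e f he hf => exact (Nat.size_le_size (Nat.sub_le _ _)).trans he
  | mul e f he hf =>
    simp only [eval, bits, add_mul]
    exact (size_mul_le_add_size _ _).trans (by omega)
  | div e f he hf => exact (Nat.size_le_size (Nat.div_le_self _ _)).trans he

theorem Expr.cost_le {s : Memory} {w : ℕ} (hw : 1 ≤ w) (hs : ∀ b a, (s b a).size ≤ w)
    (e : Expr) : e.cost s ≤ e.work * w := by
  have key := fun e => Expr.size_eval_le hw hs e
  induction e with
  | const n => exact Nat.le_mul_of_pos_right _ hw
  | read b a ha =>
    simp only [cost, work, add_mul]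
    have := key a
    have := hs b (a.eval s)
    omega
  | add e f he hf | sub e f he hf | mul e f he hf | div e f he hf =>
    simp only [cost, work, add_mul]
    have := key e
    have := key f
    omega

/-- The cell of address `0` in bank `c`, used as a counter. -/
def counter (c : ℕ) : Expr := .read c (.const 0)

/-- As long as `test` succeeds, write the value of `e` to the next cell of bank `b`; bank `c`
counts the cells that have been written. -/
def fill (b c : ℕ) (test e : Expr) : Program :=
  .loop test (.seq (.write b (counter c) e)
    (.write c (.const 0) (.add (counter c) (.const 1))))

/-- The memory `s` after the values of `f` have been written to the first `n` cells of bank `b`,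
with the counter in bank `c`. -/
def Memory.filled (s : Memory) (b c : ℕ) (f : ℕ → ℕ) (n : ℕ) : Memory :=
  fun b' a' => if b' = b ∧ a' < n then f a' else if b' = c ∧ a' = 0 then n else s b' a'

/-- A factor of the cost of one round of `fill`. -/
def fillWork (c : ℕ) (test e : Expr) : ℕ :=
  (1 + test.work) + ((counter c).work + e.work + (1 + (counter c).bits + e.bits)) +
    ((Expr.const 0).work + (Expr.add (counter c) (.const 1)).work +
      (1 + (Expr.const 0).bits + (Expr.add (counter c) (.const 1)).bits))

theorem exec_write_le {s : Memory} {w : ℕ} (hw : 1 ≤ w) (hs : ∀ b a, (s b a).size ≤ w)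
    (b : ℕ) (a v : Expr) : ∃ t, Exec (.write b a v) s t (s.set b (a.eval s) (v.eval s)) ∧
      t ≤ (a.work + v.work + (1 + a.bits + v.bits)) * w := by
  refine ⟨_, Exec.write s b a v, ?_⟩
  have h1 := Expr.cost_le hw hs a
  have h2 := Expr.cost_le hw hs v
  have h3 := Expr.size_eval_le hw hs a
  have h4 := Expr.size_eval_le hw hs v
  simp only [add_mul]
  omega

/-- If the expression `e`, evaluated after `n` rounds, has the value `f n`, then `fill` tabulates
the function `f`, at the cost of `O(w)` per round for a bound `w` on all bit lengths. -/
theorem exec_fill {s : Memory} {b c : ℕ} (hbc : b ≠ c) {test e : Expr} {f : ℕ → ℕ} {len w : ℕ}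
    (hw : 1 ≤ w) (hs : ∀ b a, (s b a).size ≤ w) (hf : ∀ n < len, (f n).size ≤ w)
    (hlen : len.size ≤ w)
    (htest : ∀ n < len, test.eval (s.filled b c f n) ≠ 0)
    (hlast : test.eval (s.filled b c f len) = 0)
    (he : ∀ n < len, e.eval (s.filled b c f n) = f n) :
    ∃ t, Exec (fill b c test e) (s.filled b c f 0) t (s.filled b c f len) ∧
      t ≤ (len + 1) * (fillWork c test e * w) := by
  have hbound : ∀ n ≤ len, ∀ b' a', (s.filled b c f n b' a').size ≤ w := by
    intro n hn b' a'
    unfold Memory.filled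
    split_ifs with h1 h2
    · exact hf _ (by omega)
    · exact (Nat.size_le_size hn).trans hlen
    · exact hs _ _
  have main : ∀ d ≤ len, ∃ t, Exec (fill b c test e) (s.filled b c f (len - d)) t
      (s.filled b c f len) ∧ t ≤ (d + 1) * (fillWork c test e * w) := by
    intro d
    induction d with
    | zero =>
      intro _
      refine ⟨_, Exec.loop_done hlast, ?_⟩
      have := Expr.cost_le hw (hbound len le_rfl) test
      simp only [fillWork, add_mul, Nat.sub_zero]
      omega
    | succ d ih =>
      intro hd
      obtain ⟨t, ht, hle⟩ := ih (by omega)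
      set n := len - (d + 1) with hn
      have hnd : len - d = n + 1 := by omega
      rw [hnd] at ht
      have hnl : n < len := by omega
      set S := s.filled b c f n with hS
      have hcnt : (counter c).eval S = n := by
        simp [counter, Expr.eval, hS, Memory.filled, Ne.symm hbc]
      obtain ⟨t₁, h₁, hle₁⟩ := exec_write_le hw (hbound n hnl.le) b (counter c) e
      rw [hcnt, he n hnl] at h₁
      have hmid : ∀ b' a', (S.set b n (f n) b' a').size ≤ w := by
        intro b' a'
        unfold Memory.set
        split_ifs
        · exact hf _ hnl
        · exact hbound n hnl.le _ _
      obtain ⟨t₂, h₂, hle₂⟩ := exec_write_le hw hmid c (.const 0) (.add (counter c) (.const 1))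
      have hnext : (S.set b n (f n)).set c ((Expr.const 0).eval (S.set b n (f n)))
          ((Expr.add (counter c) (.const 1)).eval (S.set b n (f n))) =
          s.filled b c f (n + 1) := by
        funext b' a'
        simp only [Expr.eval, counter, Memory.set, hS, Memory.filled]
        by_cases h1 : b' = b
        · subst h1
          by_cases h2 : a' = n
          · subst h2; simp [hbc]
          · have : a' < n ↔ a' < n + 1 := by omega
            simp [hbc, h2, this]
        · by_cases h2 : b' = c
          · subst h2
            by_cases h3 : a' = 0
            · simp [h1, h3]
            · simp [h1, h3]
          · simp [h1, h2]
      rw [hnext] at h₂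
      refine ⟨_, Exec.loop_step (htest n hnl) (Exec.seq h₁ h₂) ht, ?_⟩
      have h3 := Expr.cost_le hw (hbound n hnl.le) test
      have h4 : (d + 1 + 1) * (fillWork c test e * w) =
        fillWork c test e * w + (d + 1) * (fillWork c test e * w) := by ring
      rw [h4]
      refine add_le_add ?_ hle
      rw [← hS] at h3
      rw [fillWork, add_mul _ _ w, add_mul _ _ w, add_mul 1 _ w]
      omega
  simpa using main len le_rfl

end RAM

/-! ### Derived operations of expressions -/

namespace RAM.Expr

/-- The maximum of two values. -/
def max (e f : Expr) : Expr := .add e (.sub f e)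

/-- The minimum of two values. -/
def min (e f : Expr) : Expr := .sub e (.sub e f)

/-- The remainder of a division. -/
def mod (e f : Expr) : Expr := .sub e (.mul f (.div e f))

/-- A test for `e ≤ f`. -/
def le (e f : Expr) : Expr := .sub (.const 1) (.sub e f)

/-- A test for `e < f`. -/
def lt (e f : Expr) : Expr := le (.add e (.const 1)) f

/-- The conjunction of two tests. -/
def and (c d : Expr) : Expr := .mul c d

/-- The disjunction of two tests. -/
def or (c d : Expr) : Expr := .add c d

/-- A test for `e = f`. -/
def eq (e f : Expr) : Expr := and (le e f) (le f e)

/-- The value `1` or `0` according to whether the value of `e` is `0`. -/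
def not (e : Expr) : Expr := .sub (.const 1) e

/-- The value of `e` if the test `c` succeeds, and the value of `f` otherwise. -/
def ite (c e f : Expr) : Expr := .add (.mul (not (not c)) e) (.mul (not c) f)

variable (s : Memory) (c d e f : Expr)

theorem eval_const (n : ℕ) : (const n).eval s = n := rfl

theorem eval_read (b : ℕ) : (read b e).eval s = s b (e.eval s) := rfl

theorem eval_add : (add e f).eval s = e.eval s + f.eval s := rfl

theorem eval_sub : (sub e f).eval s = e.eval s - f.eval s := rfl

theorem eval_mul : (mul e f).eval s = e.eval s * f.eval s := rfl

theorem eval_div : (div e f).eval s = e.eval s / f.eval s := rfl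

theorem eval_counter (b : ℕ) : (counter b).eval s = s b 0 := rfl

theorem eval_max : (max e f).eval s = Max.max (e.eval s) (f.eval s) := by
  simp only [max, eval]; omega

theorem eval_min : (min e f).eval s = Min.min (e.eval s) (f.eval s) := by
  simp only [min, eval]; omega

theorem eval_mod : (mod e f).eval s = e.eval s % f.eval s := by
  simp only [mod, eval]
  have := Nat.div_add_mod (e.eval s) (f.eval s)
  omega

theorem eval_not : (not e).eval s = if e.eval s = 0 then 1 else 0 := by
  simp only [not, eval]; split_ifs <;> omega

theorem eval_le_ne_zero : (le e f).eval s ≠ 0 ↔ e.eval s ≤ f.eval s := by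
  simp only [le, eval]; omega

theorem eval_lt_ne_zero : (lt e f).eval s ≠ 0 ↔ e.eval s < f.eval s := by
  simp only [lt, le, eval]; omega

theorem eval_and_ne_zero : (and c d).eval s ≠ 0 ↔ c.eval s ≠ 0 ∧ d.eval s ≠ 0 := by
  simp only [and, eval, ne_eq, mul_eq_zero, not_or]

theorem eval_or_ne_zero : (or c d).eval s ≠ 0 ↔ c.eval s ≠ 0 ∨ d.eval s ≠ 0 := by
  simp only [or, eval]; omega

theorem eval_eq_ne_zero : (eq e f).eval s ≠ 0 ↔ e.eval s = f.eval s := by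
  simp only [eq, eval_and_ne_zero, eval_le_ne_zero]; omega

theorem eval_ite : (ite c e f).eval s = if c.eval s ≠ 0 then e.eval s else f.eval s := by
  by_cases h : c.eval s = 0 <;> simp [ite, eval, eval_not, h]

end RAM.Expr

/-! ### The dynamic program on sorted classes -/

/-- The data of the dynamic program. The `m` classes are numbered in the order of nonincreasing
profits `pr`; `B r` bounds the sum of `r` entries of an allocation; `v 0, v 1, …` are the sizes
that are considered, in decreasing order, up to `v T = 0`; and `q i x` is the scaled profit of
`x` items of class `i`. -/
structure SortedInstance where
  m : ℕ
  lo : ℕ → ℕ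
  up : ℕ → ℕ
  pr : ℕ → ℕ
  B : ℕ → ℕ
  v : ℕ → ℕ
  T : ℕ
  q : ℕ → ℕ → ℕ

namespace SortedInstance

open Finset

/-- The properties of the data: the sizes start at the largest possible entry, decrease until they
are `0`, at each step at most to the half (rounded down), and do not skip a bound of a class. -/
structure Valid (D : SortedInstance) : Prop where
  lo_pos : ∀ i < D.m, 0 < D.lo i
  pr_anti : ∀ i j, i ≤ j → j < D.m → D.pr j ≤ D.pr i
  B_mono : Monotone D.B
  v_zero : D.v 0 = D.B 1
  v_succ_le : ∀ t, D.v (t + 1) ≤ D.v t - 1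
  half_le : ∀ t, D.v t / 2 ≤ D.v (t + 1)
  lo_le : ∀ t, ∀ i < D.m, D.lo i < D.v t → D.lo i ≤ D.v (t + 1)
  up_le : ∀ t, ∀ i < D.m, D.up i < D.v t → D.up i ≤ D.v (t + 1)
  v_T : D.v D.T = 0
  q_zero : ∀ i, D.q i 0 = 0

variable (D : SortedInstance)

/-- Feasibility, with the condition on the sums of the largest entries replaced by the same
condition on the sums over all sets of classes. -/
structure Feas (z : ℕ → ℕ) : Prop where
  bounds : ∀ i < D.m, z i = 0 ∨ (D.lo i ≤ z i ∧ z i ≤ D.up i)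
  zero : ∀ i, D.m ≤ i → z i = 0
  sum_le : ∀ A ⊆ range D.m, ∑ i ∈ A, z i ≤ D.B #A

/-- The profit of an allocation. -/
def profit (z : ℕ → ℕ) : ℕ := ∑ i ∈ range D.m, D.pr i * z i

/-- The total number of items. -/
def total (z : ℕ → ℕ) : ℕ := ∑ i ∈ range D.m, z i

/-- The number of classes that are used. -/
def count (z : ℕ → ℕ) : ℕ := #{i ∈ range D.m | z i ≠ 0}

/-- The scaled profit of an allocation. -/
def scaled (z : ℕ → ℕ) : ℕ := ∑ i ∈ range D.m, D.q i (z i)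

/-- The base of the positional encoding of allocations. -/
def base : ℕ := D.B 1 + 1

/-- A strict upper bound on the total of a feasible allocation. -/
def cap : ℕ := D.B (D.m + 1) + 1

/-- The entries of an allocation as the digits of a number. -/
def digits (z : ℕ → ℕ) : ℕ := ∑ i ∈ range D.m, z i * D.base ^ i

/-- The encoding of an allocation by a positive number; an allocation with a smaller total has a
larger code. -/
def code (z : ℕ → ℕ) : ℕ := (D.cap - D.total z) * D.base ^ D.m + D.digits z

/-- The code of the allocation with code `c` after `x` items of class `j`, its `r`-th class, have
been added, or `0` if there is no room for them. -/
def extend (c x j r : ℕ) : ℕ :=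
  if c ≠ 0 ∧ D.cap - c / D.base ^ D.m + x ≤ D.B r then
    c - x * D.base ^ D.m + x * D.base ^ j
  else 0

/-- The table of the dynamic program. Step `τ` decides whether class `τ % m` is used with the size
`v (τ / m)`. The key consists of the number `a` of classes that the threshold has passed, the
number `r` of used classes and the scaled profit `p`; the value is the largest code of an
allocation that has been found for the key, or `0`. -/
def best : ℕ → ℕ → ℕ → ℕ → ℕ
  | 0, a, r, p => if a = 0 ∧ r = 0 ∧ p = 0 then D.cap * D.base ^ D.m else 0
  | τ + 1, a, r, p =>
    max (max (best τ a r p) (if a = τ % D.m + 1 then best τ (τ % D.m) r p else 0))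
      (if 1 ≤ r ∧ D.q (τ % D.m) (D.v (τ / D.m)) ≤ p ∧ D.lo (τ % D.m) ≤ D.v (τ / D.m) ∧
          D.v (τ / D.m) ≤ D.up (τ % D.m) then
        max
          (if a = τ % D.m + 1 then
            D.extend (best τ (τ % D.m) (r - 1) (p - D.q (τ % D.m) (D.v (τ / D.m))))
              (D.v (τ / D.m)) (τ % D.m) r
          else 0)
          (if (τ % D.m < a ∧ D.v (τ / D.m) = D.up (τ % D.m)) ∨
              (a ≤ τ % D.m ∧ D.v (τ / D.m) = D.lo (τ % D.m)) then
            D.extend (best τ a (r - 1) (p - D.q (τ % D.m) (D.v (τ / D.m))))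
              (D.v (τ / D.m)) (τ % D.m) r
          else 0)
      else 0)

variable {D}

theorem sum_update_of_eq_zero {A : Finset ℕ} {j x : ℕ} {z : ℕ → ℕ} (f : ℕ → ℕ → ℕ)
    (hj : j ∈ A) (hz : z j = 0) (hf : f j 0 = 0) :
    ∑ i ∈ A, f i (Function.update z j x i) = ∑ i ∈ A, f i (z i) + f j x := by
  rw [← add_sum_erase A _ hj, ← add_sum_erase A (fun i => f i (z i)) hj]
  have : ∑ i ∈ A.erase j, f i (Function.update z j x i) = ∑ i ∈ A.erase j, f i (z i) :=
    sum_congr rfl fun i hi => by rw [Function.update_of_ne (ne_of_mem_erase hi)]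
  simp [this, hz, hf, add_comm]

theorem total_update {j x : ℕ} {z : ℕ → ℕ} (hj : j < D.m) (hz : z j = 0) :
    D.total (Function.update z j x) = D.total z + x :=
  sum_update_of_eq_zero (fun _ y => y) (mem_range.2 hj) hz rfl

theorem digits_update {j x : ℕ} {z : ℕ → ℕ} (hj : j < D.m) (hz : z j = 0) :
    D.digits (Function.update z j x) = D.digits z + x * D.base ^ j :=
  sum_update_of_eq_zero (fun i y => y * D.base ^ i) (mem_range.2 hj) hz (by simp)

theorem scaled_update (hD : D.Valid) {j x : ℕ} {z : ℕ → ℕ} (hj : j < D.m) (hz : z j = 0) :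
    D.scaled (Function.update z j x) = D.scaled z + D.q j x :=
  sum_update_of_eq_zero D.q (mem_range.2 hj) hz (hD.q_zero j)

theorem count_update {j x : ℕ} {z : ℕ → ℕ} (hj : j < D.m) (hz : z j = 0) (hx : x ≠ 0) :
    D.count (Function.update z j x) = D.count z + 1 := by
  simp only [count, card_filter]
  rw [sum_update_of_eq_zero (fun _ y => if y ≠ 0 then 1 else 0) (mem_range.2 hj) hz (by simp)]
  simp [hx]

theorem Feas.le_B_one {z : ℕ → ℕ} (hz : D.Feas z) (i : ℕ) : z i ≤ D.B 1 := by
  by_cases hi : i < D.m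
  · simpa using hz.sum_le {i} (by simpa using hi)
  · simp [hz.zero i (by omega)]

theorem Feas.total_lt (hD : D.Valid) {z : ℕ → ℕ} (hz : D.Feas z) : D.total z < D.cap := by
  have h1 := hz.sum_le (range D.m) subset_rfl
  have h2 := hD.B_mono (Nat.le_succ D.m)
  rw [card_range] at h1
  exact Nat.lt_succ_of_le (h1.trans h2)

theorem sum_mul_pow_lt {b : ℕ} {z : ℕ → ℕ} (hz : ∀ i, z i < b) (n : ℕ) :
    ∑ i ∈ range n, z i * b ^ i < b ^ n := by
  induction n with
  | zero => simp
  | succ n ih =>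
    rw [sum_range_succ, pow_succ]
    have := Nat.mul_le_mul_right (b ^ n) (Nat.succ_le_of_lt (hz n))
    rw [Nat.succ_mul] at this
    linarith [mul_comm b (b ^ n)]

theorem Feas.digits_lt {z : ℕ → ℕ} (hz : D.Feas z) : D.digits z < D.base ^ D.m :=
  sum_mul_pow_lt (fun i => Nat.lt_succ_of_le (hz.le_B_one i)) _

theorem base_pow_pos (n : ℕ) : 0 < D.base ^ n := pow_pos (Nat.succ_pos _) _

theorem Feas.code_div {z : ℕ → ℕ} (hz : D.Feas z) :
    D.code z / D.base ^ D.m = D.cap - D.total z := by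
  rw [code, mul_comm, Nat.mul_add_div (base_pow_pos _), Nat.div_eq_of_lt hz.digits_lt, add_zero]

theorem Feas.code_ne_zero (hD : D.Valid) {z : ℕ → ℕ} (hz : D.Feas z) : D.code z ≠ 0 := by
  have := Nat.mul_pos (Nat.sub_pos_of_lt (hz.total_lt hD)) (base_pow_pos (D := D) D.m)
  rw [code]
  omega

/-- Codes are compared by the totals first. -/
theorem Feas.total_le_of_code_le (hD : D.Valid) {z z' : ℕ → ℕ} (hz : D.Feas z) (hz' : D.Feas z')
    (h : D.code z ≤ D.code z') : D.total z' ≤ D.total z := by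
  have := Nat.div_le_div_right (c := D.base ^ D.m) h
  rw [hz.code_div, hz'.code_div] at this
  have := hz.total_lt hD
  have := hz'.total_lt hD
  omega

theorem Feas.cap_sub_code_div (hD : D.Valid) {z : ℕ → ℕ} (hz : D.Feas z) :
    D.cap - D.code z / D.base ^ D.m = D.total z := by
  have := hz.total_lt hD
  rw [hz.code_div]
  omega

theorem code_update {j x : ℕ} {z : ℕ → ℕ} (hj : j < D.m) (hz : z j = 0)
    (hx : D.total z + x ≤ D.cap) :
    D.code z - x * D.base ^ D.m + x * D.base ^ j = D.code (Function.update z j x) := by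
  rw [code, code, total_update hj hz, digits_update hj hz]
  obtain ⟨k, hk⟩ := Nat.exists_eq_add_of_le hx
  have h1 : D.cap - D.total z = k + x := by omega
  have h2 : D.cap - (D.total z + x) = k := by omega
  rw [h1, h2, add_mul]
  omega

/-- Adding a new smallest entry to an allocation keeps it feasible if the new total is within the
bound: every set of classes that omits a used class can be enlarged by a larger entry. -/
theorem Feas.update (hD : D.Valid) {z : ℕ → ℕ} (hz : D.Feas z) {j x : ℕ} (hj : j < D.m)
    (hzj : z j = 0) (hlo : D.lo j ≤ x) (hup : x ≤ D.up j) (hx : ∀ i, z i ≠ 0 → x ≤ z i)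
    (hsum : D.total z + x ≤ D.B (D.count z + 1)) : D.Feas (Function.update z j x) where
  bounds i hi := by
    by_cases h : i = j
    · subst h; right; simpa using ⟨hlo, hup⟩
    · simpa [h] using hz.bounds i hi
  zero i hi := by
    rw [Function.update_of_ne (by omega)]
    exact hz.zero i hi
  sum_le A hA := by
    by_cases hjA : j ∈ A
    · have h1 := sum_update_of_eq_zero (x := x) (fun _ y => y) hjA hzj rfl
      rw [h1]
      set S := {i ∈ range D.m | z i ≠ 0} with hS
      by_cases hc : S ⊆ A
      · have h2 : #(insert j S) ≤ #A := card_le_card (insert_subset hjA hc)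
        have hjS : j ∉ S := by simp [hS, hzj]
        rw [card_insert_of_notMem hjS] at h2
        have h3 : ∑ i ∈ A, z i ≤ D.total z := sum_le_sum_of_subset hA
        have h4 : D.B (D.count z + 1) ≤ D.B #A := hD.B_mono h2
        omega
      · obtain ⟨i, hiS, hiA⟩ := not_subset.1 hc
        have hi := (mem_filter.1 hiS)
        have h2 := hz.sum_le (insert i (A.erase j))
          (insert_subset hi.1 ((erase_subset _ _).trans hA))
        have hi' : i ∉ A.erase j := fun h => hiA (mem_of_mem_erase h)
        rw [sum_insert hi', card_insert_of_notMem hi', card_erase_add_one hjA,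
          sum_erase A hzj] at h2
        have := hx i hi.2
        omega
    · rw [sum_congr rfl fun i hi => Function.update_of_ne (ne_of_mem_of_not_mem hi hjA) x z]
      exact hz.sum_le A hA

variable (D) in
/-- What is known of the allocations found for the key `a, r, p` when class `j` is to be
considered with the size `v t`: all entries are at least `v t`, those that have not yet been
considered with this size are larger, and a class that the threshold has not passed can be used at
its lower bound only. -/
structure Sound (t j a r p : ℕ) (z : ℕ → ℕ) : Prop where
  feas : D.Feas z
  count_eq : D.count z = r
  scaled_eq : D.scaled z = p
  le : ∀ i, z i ≠ 0 → D.v t ≤ z i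
  lt : ∀ i, j ≤ i → z i ≠ 0 → D.v t < z i
  low : ∀ i, a ≤ i → z i ≠ 0 → z i = D.lo i

theorem Sound.skip {t j a a' r p : ℕ} {z : ℕ → ℕ} (h : D.Sound t j a r p z) (ha : a ≤ a') :
    D.Sound t (j + 1) a' r p z where
  feas := h.feas
  count_eq := h.count_eq
  scaled_eq := h.scaled_eq
  le := h.le
  lt i hi := h.lt i (by omega)
  low i hi := h.low i (by omega)

theorem Sound.add (hD : D.Valid) {t j a a' r p : ℕ} {z : ℕ → ℕ} (h : D.Sound t j a r p z)
    (ha : a ≤ a') (hj : j < D.m) (hzj : z j = 0) (hlo : D.lo j ≤ D.v t) (hup : D.v t ≤ D.up j)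
    (hsum : D.total z + D.v t ≤ D.B (r + 1)) (hlow : a' ≤ j → D.v t = D.lo j) :
    D.Sound t (j + 1) a' (r + 1) (p + D.q j (D.v t)) (Function.update z j (D.v t)) where
  feas := h.feas.update hD hj hzj hlo hup h.le (h.count_eq ▸ hsum)
  count_eq := by
    rw [count_update hj hzj (by have := hD.lo_pos j hj; omega), h.count_eq]
  scaled_eq := by rw [scaled_update hD hj hzj, h.scaled_eq]
  le i hi := by
    by_cases hij : i = j
    · subst hij; simp
    · rw [Function.update_of_ne hij] at hi ⊢; exact h.le i hi
  lt i hji hi := by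
    rw [Function.update_of_ne (by omega)] at hi ⊢; exact h.lt i (by omega) hi
  low i hai hi := by
    by_cases hij : i = j
    · subst hij; simpa using hlow hai
    · rw [Function.update_of_ne hij] at hi ⊢; exact h.low i (by omega) hi

theorem Sound.next_size (hD : D.Valid) {t a r p : ℕ} {z : ℕ → ℕ} (h : D.Sound t D.m a r p z) :
    D.Sound (t + 1) 0 a r p z := by
  have key : ∀ i, z i ≠ 0 → D.v (t + 1) < z i := fun i hi => by
    have := h.le i hi
    have := hD.v_succ_le t
    omega
  exact ⟨h.feas, h.count_eq, h.scaled_eq, fun i hi => (key i hi).le, fun i _ => key i, h.low⟩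

theorem B_le_cap (hD : D.Valid) {r : ℕ} (hr : r ≤ D.m + 1) : D.B r ≤ D.cap :=
  (hD.B_mono hr).trans (Nat.le_succ _)

theorem count_lt_of_eq_zero {j : ℕ} {z : ℕ → ℕ} (hj : j < D.m) (hz : z j = 0) :
    D.count z < D.m := by
  conv_rhs => rw [← card_range D.m]
  refine card_lt_card ⟨filter_subset _ _, fun h => ?_⟩
  have := h (mem_range.2 hj)
  simp [hz] at this

theorem Sound.extend_eq (hD : D.Valid) {t j a r p x : ℕ} {z : ℕ → ℕ} (h : D.Sound t j a r p z)
    (hj : j < D.m) (hzj : z j = 0) (hsum : D.total z + x ≤ D.B (r + 1)) :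
    D.extend (D.code z) x j (r + 1) = D.code (Function.update z j x) := by
  have hr : r + 1 ≤ D.m + 1 := by
    rw [← h.count_eq]; have := count_lt_of_eq_zero hj hzj; omega
  rw [extend, h.feas.cap_sub_code_div hD,
    if_pos ⟨h.feas.code_ne_zero hD, hsum⟩, code_update hj hzj (hsum.trans (B_le_cap hD hr))]

theorem Sound.of_extend_ne_zero (hD : D.Valid) {t j a a' r p : ℕ} {z : ℕ → ℕ}
    (h : D.Sound t j a r p z)
    (ha : a ≤ a') (hj : j < D.m) (hzj : z j = 0) (hlo : D.lo j ≤ D.v t) (hup : D.v t ≤ D.up j)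
    (hlow : a' ≤ j → D.v t = D.lo j) (hne : D.extend (D.code z) (D.v t) j (r + 1) ≠ 0) :
    ∃ z', D.Sound t (j + 1) a' (r + 1) (p + D.q j (D.v t)) z' ∧
      D.extend (D.code z) (D.v t) j (r + 1) = D.code z' := by
  have hsum : D.total z + D.v t ≤ D.B (r + 1) := by
    rw [extend, h.feas.cap_sub_code_div hD] at hne
    by_contra hcon
    simp [hcon] at hne
  exact ⟨_, h.add hD ha hj hzj hlo hup hsum hlow, h.extend_eq hD hj hzj hsum⟩

/-- A class that is offered at the current size is unused: the threshold rules out that it has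
been used at a larger size. -/
theorem Sound.eq_zero {t j a r p : ℕ} {z : ℕ → ℕ} (h : D.Sound t j a r p z) (hj : j < D.m)
    (hlo : D.lo j ≤ D.v t) (hopt : a ≤ j ∨ D.v t = D.up j) : z j = 0 := by
  by_contra hz
  have h1 := h.lt j le_rfl hz
  rcases hopt with ha | hv
  · have := h.low j ha hz
    omega
  · have := h.feas.bounds j hj
    omega

theorem best_zero_ne_zero {a r p : ℕ} (h : D.best 0 a r p ≠ 0) :
    a = 0 ∧ r = 0 ∧ p = 0 := by
  by_contra hcon
  simp [best, hcon] at h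

theorem feas_zero : D.Feas (fun _ => 0) := ⟨fun _ _ => .inl rfl, fun _ _ => rfl, by simp⟩

theorem sound_zero (hD : D.Valid) : D.Sound 0 0 0 0 0 (fun _ => 0) where
  feas := feas_zero
  count_eq := by simp [count]
  scaled_eq := by simp [scaled, hD.q_zero]
  le := by simp
  lt := by simp
  low := by simp

theorem code_zero : D.code (fun _ => 0) = D.cap * D.base ^ D.m := by
  simp [code, total, digits]

theorem best_sound_succ (hD : D.Valid) {t j : ℕ} (hj : j < D.m)
    (ih : ∀ a r p, D.best (t * D.m + j) a r p ≠ 0 →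
      ∃ z, D.Sound t j a r p z ∧ D.best (t * D.m + j) a r p = D.code z) (a r p : ℕ)
    (h : D.best (t * D.m + (j + 1)) a r p ≠ 0) :
    ∃ z, D.Sound t (j + 1) a r p z ∧ D.best (t * D.m + (j + 1)) a r p = D.code z := by
  have hm : 0 < D.m := by omega
  have hmod : (t * D.m + j) % D.m = j := by simp [Nat.mod_eq_of_lt hj, Nat.add_mod]
  have hdiv : (t * D.m + j) / D.m = t := by
    rw [mul_comm, Nat.mul_add_div hm, Nat.div_eq_of_lt hj, add_zero]
  -- the property to be shown holds for `0`, and is inherited by maxima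
  let Q : ℕ → Prop := fun c => c ≠ 0 → ∃ z, D.Sound t (j + 1) a r p z ∧ c = D.code z
  have hmax : ∀ x y, Q x → Q y → Q (max x y) := fun x y hx hy => by
    rcases max_choice x y with h | h <;> rw [h] <;> assumption
  have hite : ∀ (c : Prop) [Decidable c] x, (c → Q x) → Q (if c then x else 0) := by
    intro c _ x hx
    split_ifs with hc
    exacts [hx hc, fun h => absurd rfl h]
  have hext : ∀ c r, D.extend c (D.v t) j r ≠ 0 → c ≠ 0 := by
    intro c r hc hc0
    simp [extend, hc0] at hc
  suffices Q (D.best (t * D.m + (j + 1)) a r p) from this h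
  rw [← add_assoc, best, hmod, hdiv]
  refine hmax _ _ (hmax _ _ ?_ (hite _ _ ?_)) (hite _ _ ?_)
  · intro h
    obtain ⟨z, hz, hc⟩ := ih _ _ _ h
    exact ⟨z, hz.skip le_rfl, hc⟩
  · intro ha h
    obtain ⟨z, hz, hc⟩ := ih _ _ _ h
    exact ⟨z, hz.skip (by omega), hc⟩
  · rintro ⟨hr, hq, hlo, hup⟩
    obtain ⟨r, rfl⟩ : ∃ r', r = r' + 1 := ⟨r - 1, by omega⟩
    obtain ⟨p, rfl⟩ : ∃ p', p = p' + D.q j (D.v t) := ⟨p - D.q j (D.v t), by omega⟩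
    rw [Nat.add_sub_cancel, Nat.add_sub_cancel]
    refine hmax _ _ (hite _ _ ?_) (hite _ _ ?_)
    · intro ha h
      obtain ⟨z, hz, hc⟩ := ih _ _ _ (hext _ _ h)
      rw [hc] at h ⊢
      exact hz.of_extend_ne_zero hD (by omega) hj (hz.eq_zero hj hlo (.inl le_rfl)) hlo hup
        (by omega) h
    · intro ha h
      obtain ⟨z, hz, hc⟩ := ih _ _ _ (hext _ _ h)
      rw [hc] at h ⊢
      exact hz.of_extend_ne_zero hD le_rfl hj (hz.eq_zero hj hlo (by omega)) hlo hup
        (by omega) h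

theorem best_sound (hD : D.Valid) (t : ℕ) : ∀ j ≤ D.m, ∀ a r p,
    D.best (t * D.m + j) a r p ≠ 0 →
      ∃ z, D.Sound t j a r p z ∧ D.best (t * D.m + j) a r p = D.code z := by
  induction t with
  | zero =>
    intro j
    induction j with
    | zero =>
      intro _ a r p h
      simp only [zero_mul, add_zero] at h ⊢
      obtain ⟨rfl, rfl, rfl⟩ := best_zero_ne_zero h
      exact ⟨_, sound_zero hD, by simp [best, code_zero]⟩
    | succ j ih =>
      intro hj a r p h
      exact best_sound_succ hD hj (ih (by omega)) a r p h
  | succ t iht =>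
    intro j
    induction j with
    | zero =>
      intro _ a r p h
      have : (t + 1) * D.m + 0 = t * D.m + D.m := by ring
      rw [this] at h ⊢
      obtain ⟨z, hz, hc⟩ := iht D.m le_rfl a r p h
      exact ⟨z, hz.next_size hD, hc⟩
    | succ j ih =>
      intro hj a r p h
      exact best_sound_succ hD hj (ih (by omega)) a r p h

end SortedInstance

/-! ### The dynamic program finds every threshold allocation -/

namespace SortedInstance

open Finset

variable {D : SortedInstance}

variable (D) in
/-- An allocation that is described by thresholds: a used class `i` has the size `v (hr i)`, moved
into the bounds of the class, where `hr` is monotone. -/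
structure Threshold (w hr : ℕ → ℕ) : Prop where
  feas : D.Feas w
  eq_clip : ∀ i < D.m, w i ≠ 0 → w i = max (D.lo i) (min (D.up i) (D.v (hr i)))
  mono : ∀ i j, i ≤ j → j < D.m → hr i ≤ hr j
  size : ∀ i, w i ≠ 0 → ∃ s, w i = D.v s

variable (D) in
/-- The part of the allocation `w` that is decided before class `j` is considered with the size
`v t`. -/
def part (w : ℕ → ℕ) (t j : ℕ) : ℕ → ℕ :=
  fun i => if D.v t < w i ∨ (D.v t = w i ∧ i < j) then w i else 0

theorem Feas.restrict {w z : ℕ → ℕ} (hw : D.Feas w) (hz : ∀ i, z i = 0 ∨ z i = w i) :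
    D.Feas z where
  bounds i hi := by
    rcases hz i with h | h
    · exact .inl h
    · rw [h]; exact hw.bounds i hi
  zero i hi := by
    rcases hz i with h | h
    · exact h
    · rw [h]; exact hw.zero i hi
  sum_le A hA := (sum_le_sum fun i _ => by rcases hz i with h | h <;> omega).trans
    (hw.sum_le A hA)

theorem Feas.part {w : ℕ → ℕ} (hw : D.Feas w) (t j : ℕ) : D.Feas (D.part w t j) :=
  hw.restrict fun i => by unfold SortedInstance.part; split_ifs <;> simp

theorem Feas.total_le {z : ℕ → ℕ} (hz : D.Feas z) : D.total z ≤ D.B (D.count z) := by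
  have := hz.sum_le {i ∈ range D.m | z i ≠ 0} (filter_subset _ _)
  rwa [sum_filter_ne_zero] at this

theorem part_succ_of_eq {w : ℕ → ℕ} {t j : ℕ} (h : w j = D.v t) :
    D.part w t j j = 0 ∧
      D.part w t (j + 1) = Function.update (D.part w t j) j (D.v t) := by
  constructor
  · simp [part, h]
  · funext i
    by_cases hij : i = j
    · subst hij; simp [part, h]
    · have : i < j + 1 ↔ i < j := by omega
      simp [part, hij, this]

theorem part_succ_of_ne {w : ℕ → ℕ} {t j : ℕ} (h : w j ≠ D.v t ∨ w j = 0) :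
    D.part w t (j + 1) = D.part w t j := by
  funext i
  by_cases hij : i = j
  · subst hij
    unfold part
    split_ifs <;> omega
  · have : i < j + 1 ↔ i < j := by omega
    simp [part, this]

theorem v_antitone (hD : D.Valid) : Antitone D.v :=
  antitone_nat_of_succ_le fun t => (hD.v_succ_le t).trans (Nat.sub_le _ _)

theorem v_lt_of_lt (hD : D.Valid) {s t : ℕ} (h : s < t) (ht : D.v t ≠ 0) : D.v t < D.v s := by
  have h1 := v_antitone hD (Nat.succ_le_of_lt h)
  have h2 := hD.v_succ_le s
  simp only [Nat.succ_eq_add_one] at h1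
  omega

theorem Threshold.part_next_size (hD : D.Valid) {w hr : ℕ → ℕ} (hw : D.Threshold w hr) (t : ℕ) :
    D.part w (t + 1) 0 = D.part w t D.m := by
  funext i
  by_cases hi : w i = 0
  · simp [part, hi]
  have him : i < D.m := by
    by_contra hcon
    exact hi (hw.feas.zero i (by omega))
  have : D.v (t + 1) < w i ↔ D.v t ≤ w i := by
    constructor
    · intro h
      obtain ⟨s, hs⟩ := hw.size i hi
      rw [hs] at h ⊢
      refine v_antitone hD ?_
      by_contra hcon
      have := v_antitone hD (show t + 1 ≤ s by omega)
      omega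
    · intro h
      have := hD.v_succ_le t
      omega
  have h2 : (D.v t < w i ∨ D.v t = w i) ↔ D.v t ≤ w i := by omega
  simp [part, him, this, h2]

variable (D) in
/-- The dynamic program has kept up with the threshold allocation `w`: for the key of the part of
`w` that is decided, it has found an allocation whose total is not larger. -/
def Reached (w hr : ℕ → ℕ) (t j : ℕ) : Prop :=
  ∃ a z, a ≤ D.m ∧ (∀ i < D.m, i < a ↔ hr i < t ∨ (hr i = t ∧ i < j)) ∧
    D.Sound t j a (D.count (D.part w t j)) (D.scaled (D.part w t j)) z ∧
    D.best (t * D.m + j) a (D.count (D.part w t j)) (D.scaled (D.part w t j)) = D.code z ∧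
    D.total z ≤ D.total (D.part w t j)

theorem reached_of_le (hD : D.Valid) {w hr : ℕ → ℕ} {t j a : ℕ} (hj : j ≤ D.m) (ha : a ≤ D.m)
    (hptr : ∀ i < D.m, i < a ↔ hr i < t ∨ (hr i = t ∧ i < j)) {z : ℕ → ℕ} (hz : D.Feas z)
    (hle : D.code z ≤
      D.best (t * D.m + j) a (D.count (D.part w t j)) (D.scaled (D.part w t j)))
    (htot : D.total z ≤ D.total (D.part w t j)) : D.Reached w hr t j := by
  have hne := hz.code_ne_zero hD
  obtain ⟨z', hz', hc⟩ := best_sound hD t j hj a _ _ (by omega : D.best (t * D.m + j) a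
    (D.count (D.part w t j)) (D.scaled (D.part w t j)) ≠ 0)
  rw [hc] at hle
  exact ⟨a, z', ha, hptr, hz', hc, (hz.total_le_of_code_le hD hz'.feas hle).trans htot⟩

/-- The decisions that lead to the threshold allocation are among the options of the dynamic
program: a class is added when the threshold passes it, or after that at its upper bound, or
before that at its lower bound. -/
theorem Threshold.reached_succ (hD : D.Valid) {w hr : ℕ → ℕ} (hw : D.Threshold w hr) {t j : ℕ}
    (hj : j < D.m) (h : D.Reached w hr t j) : D.Reached w hr t (j + 1) := by
  obtain ⟨a, z, ha, hptr, hz, hc, htot⟩ := h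
  have hm : 0 < D.m := by omega
  have hmod : (t * D.m + j) % D.m = j := by simp [Nat.mod_eq_of_lt hj, Nat.add_mod]
  have hdiv : (t * D.m + j) / D.m = t := by
    rw [mul_comm, Nat.mul_add_div hm, Nat.div_eq_of_lt hj, add_zero]
  have hptrj := hptr j hj
  -- the threshold passes class `j` now exactly if it stands at `j`
  have haj : hr j = t → a = j := by
    intro hrj
    by_contra hcon
    have hlt : a < j := by omega
    have h1 := hptr a (by omega)
    have h2 := hw.mono a j hlt.le hj
    omega
  have hptr_pass : hr j = t →
      ∀ i < D.m, i < j + 1 ↔ hr i < t ∨ (hr i = t ∧ i < j + 1) := by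
    intro hrj i hi
    have h1 := hptr i hi
    rw [haj hrj] at h1
    by_cases hij : i = j
    · subst hij; omega
    · omega
  have hptr_stay : hr j ≠ t → ∀ i < D.m, i < a ↔ hr i < t ∨ (hr i = t ∧ i < j + 1) := by
    intro hrj i hi
    have h1 := hptr i hi
    by_cases hij : i = j
    · subst hij; omega
    · omega
  by_cases hwj : w j = D.v t ∧ w j ≠ 0
  · obtain ⟨hp0, hp⟩ := part_succ_of_eq (D := D) hwj.1
    have hclip := hw.eq_clip j hj hwj.2
    have hbd := (hw.feas.bounds j hj).resolve_left hwj.2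
    rw [hwj.1] at hclip hbd
    have hvt : D.v t ≠ 0 := hwj.1 ▸ hwj.2
    have htotp := total_update (x := D.v t) hj hp0
    have hcount := count_update hj hp0 hvt
    have hscaled := scaled_update hD (x := D.v t) hj hp0
    rw [← hp] at htotp hcount hscaled
    have hB := (hw.feas.part t (j + 1)).total_le
    rw [htotp, hcount] at hB
    have hsum : D.total z + D.v t ≤ D.B (D.count (D.part w t j) + 1) := by omega
    have hopt : a ≤ j ∨ D.v t = D.up j := by
      by_contra hcon
      have h1 : hr j < t := by omega
      have := v_lt_of_lt hD h1 hvt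
      omega
    have hzj := hz.eq_zero hj hbd.1 hopt
    have hext := hz.extend_eq hD hj hzj hsum
    have hfeas := hz.feas.update hD hj hzj hbd.1 hbd.2 hz.le (hz.count_eq ▸ hsum)
    have htot' : D.total (Function.update z j (D.v t)) ≤ D.total (D.part w t (j + 1)) := by
      rw [total_update hj hzj, htotp]
      omega
    by_cases hrj : hr j = t
    · refine reached_of_le hD hj (by omega) (hptr_pass hrj) hfeas ?_ htot'
      rw [hcount, hscaled, ← add_assoc, best, hmod, hdiv, Nat.add_sub_cancel, Nat.add_sub_cancel,
        ← hext, ← hc, haj hrj]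
      refine le_max_of_le_right ?_
      rw [if_pos ⟨by omega, by omega, hbd⟩, if_pos rfl]
      exact le_max_left _ _
    · refine reached_of_le hD hj ha (hptr_stay hrj) hfeas ?_ htot'
      rw [hcount, hscaled, ← add_assoc, best, hmod, hdiv, Nat.add_sub_cancel, Nat.add_sub_cancel,
        ← hext, ← hc]
      refine le_max_of_le_right ?_
      have hcase : (j < a ∧ D.v t = D.up j) ∨ (a ≤ j ∧ D.v t = D.lo j) := by
        by_cases haj : j < a
        · exact .inl ⟨haj, by omega⟩
        · have h1 : t < hr j := by omega
          rcases Nat.eq_zero_or_pos (D.v (hr j)) with h0 | h0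
          · exact .inr ⟨by omega, by omega⟩
          · have := v_lt_of_lt hD h1 (by omega)
            exact .inr ⟨by omega, by omega⟩
      rw [if_pos ⟨by omega, by omega, hbd⟩, if_pos hcase]
      exact le_max_right _ _
  · have hp := part_succ_of_ne (D := D) (w := w) (t := t) (j := j) (by tauto)
    by_cases hrj : hr j = t
    · refine reached_of_le hD hj (by omega) (hptr_pass hrj) hz.feas ?_ (hp ▸ htot)
      rw [hp, ← add_assoc, best, hmod, hdiv, ← hc, haj hrj, if_pos rfl]
      exact le_max_of_le_left (le_max_right _ _)
    · refine reached_of_le hD hj ha (hptr_stay hrj) hz.feas ?_ (hp ▸ htot)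
      rw [hp, ← add_assoc, best, ← hc]
      exact le_max_of_le_left (le_max_left _ _)

theorem Threshold.reached_next_size (hD : D.Valid) {w hr : ℕ → ℕ} (hw : D.Threshold w hr) {t : ℕ}
    (h : D.Reached w hr t D.m) : D.Reached w hr (t + 1) 0 := by
  obtain ⟨a, z, ha, hptr, hz, hc, htot⟩ := h
  have he : (t + 1) * D.m + 0 = t * D.m + D.m := by ring
  refine ⟨a, z, ha, fun i hi => ?_, ?_⟩
  · rw [hptr i hi]
    omega
  · rw [hw.part_next_size hD, he]
    exact ⟨hz.next_size hD, hc, htot⟩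

theorem Threshold.reached_zero (hD : D.Valid) {w hr : ℕ → ℕ} (hw : D.Threshold w hr) :
    D.Reached w hr 0 0 := by
  have hp : D.part w 0 0 = fun _ => 0 := by
    funext i
    have := hw.feas.le_B_one i
    simp [part, hD.v_zero, this]
  refine ⟨0, fun _ => 0, Nat.zero_le _, by simp, ?_⟩
  have hs := sound_zero hD
  rw [hp, hs.count_eq, hs.scaled_eq]
  exact ⟨hs, by simp [best, code_zero], le_rfl⟩

theorem Threshold.reached (hD : D.Valid) {w hr : ℕ → ℕ} (hw : D.Threshold w hr) (t : ℕ) :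
    ∀ j ≤ D.m, D.Reached w hr t j := by
  have step : ∀ t, D.Reached w hr t 0 → ∀ j ≤ D.m, D.Reached w hr t j := by
    intro t h j
    induction j with
    | zero => exact fun _ => h
    | succ j ih => exact fun hj => hw.reached_succ hD hj (ih (by omega))
  induction t with
  | zero => exact step 0 (hw.reached_zero hD)
  | succ t ih => exact step _ (hw.reached_next_size hD (ih _ le_rfl))

/-- In the end, the dynamic program has an entry for the scaled profit of every threshold
allocation. -/
theorem Threshold.exists_best_ne_zero (hD : D.Valid) {w hr : ℕ → ℕ} (hw : D.Threshold w hr) :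
    ∃ a r, a ≤ D.m ∧ r ≤ D.m ∧ D.best (D.T * D.m) a r (D.scaled w) ≠ 0 := by
  obtain ⟨a, z, ha, -, hz, hc, -⟩ := hw.reached hD D.T 0 (Nat.zero_le _)
  have hp : D.part w D.T 0 = w := by
    funext i
    simp only [part, hD.v_T]
    split_ifs <;> omega
  rw [hp, add_zero] at hc
  refine ⟨a, _, ha, ?_, hc ▸ hz.feas.code_ne_zero hD⟩
  exact (card_filter_le _ _).trans (card_range _).le

/-! ### Rounding an optimal allocation to a threshold allocation -/

variable (D) in
/-- The largest entry at or after class `i` that is above the lower bound of its class. -/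
def height (z : ℕ → ℕ) (i : ℕ) : ℕ := {j ∈ range D.m | i ≤ j ∧ D.lo j < z j}.sup z

/-- A unit can be moved from a class to another class with a smaller entry. -/
theorem Feas.transfer {z : ℕ → ℕ} (hz : D.Feas z) {i j : ℕ} (hi : i < D.m) (hj : j < D.m)
    (hi0 : z i ≠ 0) (hup : z i < D.up i) (hlo : D.lo j < z j) (hlt : z i < z j) :
    D.Feas (Function.update (Function.update z j (z j - 1)) i (z i + 1)) := by
  have hij : i ≠ j := by rintro rfl; omega
  have hbi := hz.bounds i hi
  have hbj := hz.bounds j hj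
  refine ⟨fun k hk => ?_, fun k hk => ?_, fun A hA => ?_⟩
  · by_cases hki : k = i
    · subst hki; simp only [Function.update_self]; omega
    · by_cases hkj : k = j
      · subst hkj; simp only [Function.update_self, Function.update_of_ne hki]; omega
      · simpa [hki, hkj] using hz.bounds k hk
  · rw [Function.update_of_ne (by omega), Function.update_of_ne (by omega)]
    exact hz.zero k hk
  · have hA' := hz.sum_le A hA
    by_cases hiA : i ∈ A
    · rw [sum_update_of_mem hiA]
      by_cases hjA : j ∈ A
      · have hjA' : j ∈ A \ {i} := by simp [hjA, hij.symm]
        rw [sum_update_of_mem hjA']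
        have h1 := sum_sdiff (f := z) (singleton_subset_iff.2 hiA)
        have h2 := sum_sdiff (f := z) (singleton_subset_iff.2 hjA')
        rw [sum_singleton] at h1 h2
        omega
      · have h1 : j ∉ A \ {i} := fun h => hjA (mem_sdiff.1 h).1
        rw [sum_update_of_notMem h1]
        -- replace `i` by `j`
        have h2 := hz.sum_le (insert j (A \ {i})) (insert_subset (mem_range.2 hj)
          (sdiff_subset.trans hA))
        have hcard : #(A \ {i}) + 1 = #A := by
          rw [sdiff_singleton_eq_erase, card_erase_add_one hiA]
        rw [sum_insert h1, card_insert_of_notMem h1, hcard] at h2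
        omega
    · rw [sum_update_of_notMem hiA]
      by_cases hjA : j ∈ A
      · rw [sum_update_of_mem hjA]
        have h1 := sum_sdiff (f := z) (singleton_subset_iff.2 hjA)
        rw [sum_singleton] at h1
        omega
      · rwa [sum_update_of_notMem hjA]

theorem sum_transfer (f : ℕ → ℕ) {z : ℕ → ℕ} {i j : ℕ} (hi : i < D.m) (hj : j < D.m)
    (hij : i ≠ j) (hzj : z j ≠ 0) :
    ∑ k ∈ range D.m, f k * Function.update (Function.update z j (z j - 1)) i (z i + 1) k + f j =
      ∑ k ∈ range D.m, f k * z k + f i := by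
  have hj' : j ∈ (range D.m).erase i := by simp [hij.symm, hj]
  rw [← add_sum_erase _ _ (mem_range.2 hi), ← add_sum_erase _ _ hj',
    ← add_sum_erase _ (fun k => f k * z k) (mem_range.2 hi),
    ← add_sum_erase _ (fun k => f k * z k) hj']
  have : ∑ k ∈ ((range D.m).erase i).erase j,
      f k * Function.update (Function.update z j (z j - 1)) i (z i + 1) k =
      ∑ k ∈ ((range D.m).erase i).erase j, f k * z k :=
    sum_congr rfl fun k hk => by
      rw [mem_erase, mem_erase] at hk
      rw [Function.update_of_ne hk.2.1, Function.update_of_ne hk.1]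
  rw [this, Function.update_self, Function.update_of_ne hij.symm, Function.update_self]
  obtain ⟨y, hy⟩ := Nat.exists_eq_succ_of_ne_zero hzj
  rw [hy]
  simp only [Nat.succ_eq_add_one, Nat.add_sub_cancel]
  ring

theorem finite_feas : {z | D.Feas z}.Finite := by
  refine Set.Finite.of_finite_image (f := fun (z : ℕ → ℕ) (i : Fin D.m) => z i) ?_ ?_
  · refine (Set.Finite.pi' (t := fun _ : Fin D.m => Set.Iic (D.B 1))
      fun _ => Set.finite_Iic _).subset ?_
    rintro _ ⟨z, hz, rfl⟩ i
    exact Feas.le_B_one hz i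
  · intro z hz y hy h
    funext i
    by_cases hi : i < D.m
    · exact congrFun h ⟨i, hi⟩
    · rw [Feas.zero hz i (by omega), Feas.zero hy i (by omega)]

/-- In an optimal allocation that favours the classes with small numbers, an entry can be smaller
than a later one only if one of them is at the bound of its class, because a unit could be moved
otherwise. -/
theorem exists_optimal (hD : D.Valid) : ∃ z, D.Feas z ∧ (∀ y, D.Feas y → D.profit y ≤ D.profit z) ∧
    ∀ i j, i < j → j < D.m → z i ≠ 0 → z i < D.up i → D.lo j < z j → z j ≤ z i := by
  obtain ⟨z, hz, hmax⟩ := Set.exists_max_image {z | D.Feas z}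
    (fun z => toLex (D.profit z, ∑ i ∈ range D.m, (D.m - i) * z i)) finite_feas
    ⟨_, feas_zero⟩
  refine ⟨z, hz, fun y hy => ?_, fun i j hij hj hi0 hup hlo => ?_⟩
  · have := hmax y hy
    rw [Prod.Lex.toLex_le_toLex] at this
    rcases this with h | h
    exacts [h.le, h.1.le]
  · by_contra hlt
    have h := hmax _ (Feas.transfer hz (hij.trans hj) hj hi0 hup hlo (by omega))
    have h1 := sum_transfer D.pr (hij.trans hj) hj hij.ne (z := z) (by omega)
    have h2 := sum_transfer (fun i => D.m - i) (hij.trans hj) hj hij.ne (z := z) (by omega)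
    have h3 := hD.pr_anti i j hij.le hj
    rw [Prod.Lex.toLex_le_toLex] at h
    simp only [profit] at h h1 h2
    omega

theorem exists_v_eq (hD : D.Valid) {c : ℕ} (hc : 0 < c) (hcB : c ≤ D.B 1)
    (h : ∀ t, c < D.v t → c ≤ D.v (t + 1)) : ∃ s, c = D.v s := by
  have hex : ∃ t, D.v t ≤ c := ⟨D.T, by rw [hD.v_T]; omega⟩
  refine ⟨Nat.find hex, le_antisymm ?_ (Nat.find_spec hex)⟩
  rcases hn : Nat.find hex with _ | n
  · rw [hD.v_zero]; exact hcB
  · exact h n (by have := Nat.find_min hex (m := n) (by omega); omega)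

theorem le_height {z : ℕ → ℕ} {i j : ℕ} (hij : i ≤ j) (hj : j < D.m) (h : D.lo j < z j) :
    z j ≤ D.height z i :=
  le_sup (f := z) (by simp [hij, hj, h])

/-- The thresholds of an optimal allocation, rounded down to the next size, give a threshold
allocation with at least half the entries. -/
theorem exists_threshold (hD : D.Valid) :
    ∃ w hr, D.Threshold w hr ∧ ∀ y, D.Feas y → D.profit y ≤ 2 * D.profit w := by
  obtain ⟨z, hz, hopt, hexch⟩ := exists_optimal hD
  have hex : ∀ i, ∃ t, D.v t ≤ D.height z i := fun i => ⟨D.T, by rw [hD.v_T]; exact Nat.zero_le _⟩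
  set hr : ℕ → ℕ := fun i => Nat.find (hex i) with hhr
  have hspec : ∀ i, D.v (hr i) ≤ D.height z i := fun i => Nat.find_spec (hex i)
  set w : ℕ → ℕ := fun i => if z i = 0 then 0 else max (D.lo i) (min (D.up i) (D.v (hr i)))
    with hw
  have hheight : ∀ i < D.m, z i ≠ 0 → min (D.up i) (D.height z i) ≤ z i := by
    intro i hi hzi
    by_cases hup : z i < D.up i
    · refine (min_le_right _ _).trans (Finset.sup_le fun j hj => ?_)
      rw [mem_filter, mem_range] at hj
      rcases hj.2.1.eq_or_lt with rfl | hij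
      · exact le_rfl
      · exact hexch i j hij hj.1 hzi hup hj.2.2
    · exact (min_le_left _ _).trans (by omega)
  have hwz : ∀ i, w i ≤ z i := by
    intro i
    by_cases hzi : z i = 0
    · simp [hw, hzi]
    · have hi : i < D.m := by
        by_contra hcon
        exact hzi (hz.zero i (by omega))
      have h1 := hheight i hi hzi
      have h2 := hspec i
      have h3 := hz.bounds i hi
      simp only [hw, if_neg hzi]
      omega
  have hzw : ∀ i < D.m, z i ≤ 2 * w i := by
    intro i hi
    by_cases hzi : z i = 0
    · simp [hzi]
    · have h3 := hz.bounds i hi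
      simp only [hw, if_neg hzi]
      by_cases hlo : z i = D.lo i
      · omega
      · have h4 : z i ≤ D.height z i := le_height le_rfl hi (by omega)
        have h5 : z i ≤ 2 * D.v (hr i) := by
          rcases hn : hr i with _ | n
          · have := hz.le_B_one i
            rw [hD.v_zero]
            omega
          · have := Nat.find_min (hex i) (m := n) (by simp only [hhr] at hn; omega)
            have := hD.half_le n
            omega
        omega
  refine ⟨w, hr, ⟨⟨fun i hi => ?_, fun i hi => ?_, fun A hA => ?_⟩, fun i hi hwi => ?_,
    fun i j hij hj => ?_, fun i hwi => ?_⟩, fun y hy => (hopt y hy).trans ?_⟩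
  · by_cases hzi : z i = 0
    · simp [hw, hzi]
    · have := hz.bounds i hi
      simp only [hw, if_neg hzi]
      omega
  · simp [hw, hz.zero i hi]
  · exact (sum_le_sum fun i _ => hwz i).trans (hz.sum_le A hA)
  · by_cases hzi : z i = 0
    · simp [hw, hzi] at hwi
    · simp [hw, hzi]
  · refine Nat.find_mono fun t ht => ht.trans ?_
    refine Finset.sup_mono fun k hk => ?_
    simp only [mem_filter] at hk ⊢
    exact ⟨hk.1, hij.trans hk.2.1, hk.2.2⟩
  · by_cases hzi : z i = 0
    · simp [hw, hzi] at hwi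
    have hi : i < D.m := by
      by_contra hcon
      exact hzi (hz.zero i (by omega))
    have h1 := hz.bounds i hi
    have h2 := hz.le_B_one i
    have h3 := hD.lo_pos i hi
    have h4 := hwz i
    have hwi' : w i = max (D.lo i) (min (D.up i) (D.v (hr i))) := if_neg hzi
    have h5 : w i = D.lo i ∨ w i = D.up i ∨ w i = D.v (hr i) := by omega
    rcases h5 with h5 | h5 | h5
    · rw [h5]
      exact exists_v_eq hD (by omega) (by omega) fun t => hD.lo_le t i hi
    · rw [h5]
      exact exists_v_eq hD (by omega) (by omega) fun t => hD.up_le t i hi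
    · exact ⟨_, h5⟩
  · simp only [profit, mul_sum]
    refine sum_le_sum fun i hi => ?_
    have := Nat.mul_le_mul_left (D.pr i) (hzw i (mem_range.1 hi))
    linarith

/-- If profits are scaled by `m * E / V` for a value `V` that is at least the profit of a single
class and at most the optimum, the dynamic program finds an approximate optimum. -/
theorem exists_best_ne_zero_and_profit_le (hD : D.Valid) {E V : ℕ}
    (hq : ∀ i x, D.q i x = D.pr i * x * D.m * E / V)
    (hV : ∀ z, D.Feas z → ∀ i < D.m, D.pr i * z i ≤ V) (hV' : ∃ y, D.Feas y ∧ V ≤ D.profit y) :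
    ∃ a r p, a ≤ D.m ∧ r ≤ D.m ∧ p ≤ D.m * D.m * E ∧ D.best (D.T * D.m) a r p ≠ 0 ∧
      ∀ z, D.Feas z → p ≤ D.scaled z → ∀ y, D.Feas y →
        E * D.profit y ≤ 2 * E * D.profit z + 2 * D.profit y := by
  obtain ⟨w, hr, hw, hhalf⟩ := exists_threshold hD
  obtain ⟨a, r, ha, hr', hne⟩ := hw.exists_best_ne_zero hD
  refine ⟨a, r, _, ha, hr', ?_, hne, fun z hz hle y hy => ?_⟩
  · rw [scaled, mul_assoc]
    refine (sum_le_card_nsmul _ _ (D.m * E) fun i hi => ?_).trans (by simp)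
    rw [hq]
    have h1 := hV w hw.feas i (mem_range.1 hi)
    rw [mul_assoc]
    exact Nat.div_le_of_le_mul (Nat.mul_le_mul_right _ h1)
  · obtain ⟨o, ho, hVo⟩ := hV'
    have hwo := hhalf o ho
    have hwy := hhalf y hy
    rcases Nat.eq_zero_or_pos V with hV0 | hV0
    -- here the scaled profits are `0` by convention, but so are all profits
    · have : D.profit w = 0 := sum_eq_zero fun i hi => by
        have := hV w hw.feas i (mem_range.1 hi)
        omega
      have : D.profit y = 0 := by omega
      simp [this]
    rcases Nat.eq_zero_or_pos D.m with hm | hm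
    · have : D.profit y = 0 := by simp [profit, hm]
      simp [this]
    have h1 : D.scaled z * V ≤ D.profit z * (D.m * E) := by
      simp only [scaled, profit, sum_mul]
      refine sum_le_sum fun i _ => ?_
      rw [hq, ← mul_assoc]
      exact Nat.div_mul_le_self _ _
    have h2 : D.profit w * (D.m * E) ≤ (D.scaled w + D.m) * V := by
      have : D.scaled w + D.m = ∑ i ∈ range D.m, (D.q i (w i) + 1) := by
        simp [sum_add_distrib, scaled]
      rw [this]
      simp only [profit, sum_mul]
      refine sum_le_sum fun i _ => ?_
      rw [hq, ← mul_assoc]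
      rw [mul_comm _ V]
      exact (Nat.lt_mul_div_succ _ hV0).le
    have h3 : D.profit w * E ≤ D.profit z * E + V := by
      have h4 := Nat.mul_le_mul_right V hle
      refine Nat.le_of_mul_le_mul_left ?_ hm
      nlinarith
    rcases Nat.lt_or_ge E 2 with hE | hE
    · have := Nat.mul_le_mul_right (D.profit y) hE.le
      omega
    · obtain ⟨k, rfl⟩ := Nat.exists_eq_add_of_le hE
      have h4 := Nat.mul_le_mul_left k hwy
      nlinarith

end SortedInstance

/-! ### Sums of the largest entries -/

namespace GAPInstance

open Finset

theorem sum_le_sum_take_of_sublist {l : List ℕ} (hl : l.Pairwise (fun a b => b ≤ a)) :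
    ∀ {l' : List ℕ} {r : ℕ}, l'.Sublist l → l'.length ≤ r → l'.sum ≤ (l.take r).sum := by
  induction l with
  | nil => intro l' r h _; simp [List.sublist_nil.1 h]
  | cons a l ih =>
    intro l' r h hr
    rw [List.pairwise_cons] at hl
    rcases l' with _ | ⟨b, l'⟩
    · simp
    obtain ⟨r, rfl⟩ : ∃ k, r = k + 1 := ⟨r - 1, by simp at hr; omega⟩
    have hb : b ≤ a := by
      rcases List.mem_cons.1 (h.subset List.mem_cons_self) with rfl | hb
      exacts [le_rfl, hl.1 b hb]
    have := ih hl.2 (List.cons_sublist_cons'.1 h |>.elim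
      (fun h => (List.sublist_cons_self _ _).trans h) (fun h => h.2)) (r := r) (by simpa using hr)
    simp only [List.take_succ_cons, List.sum_cons]
    omega

theorem sum_le_topSum {n r : ℕ} (x : Fin n → ℕ) {A : Finset (Fin n)} (hA : #A ≤ r) :
    ∑ i ∈ A, x i ≤ topSum x r := by
  have hsub : (A.toList.map x).Subperm (List.ofFn x) := by
    rw [List.ofFn_eq_map]
    obtain ⟨l, hl, hsub⟩ := List.subperm_of_subset A.nodup_toList fun i _ => List.mem_finRange i
    exact ⟨l.map x, hl.map x, hsub.map x⟩
  set c := (A.toList.map x).insertionSort (fun a b => b ≤ a) with hc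
  have hperm : c.Perm (A.toList.map x) := List.perm_insertionSort _ _
  have hsum : ∑ i ∈ A, x i = c.sum := by rw [hperm.sum_eq, Finset.sum_map_toList]
  rw [hsum]
  refine sum_le_sum_take_of_sublist (List.pairwise_insertionSort (fun a b : ℕ => b ≤ a) _)
    (List.sublist_insertionSort' (List.pairwise_insertionSort (fun a b : ℕ => b ≤ a) _)
      (hperm.subperm.trans hsub)) ?_
  rw [hperm.length_eq]
  simpa using hA

theorem exists_topSum_eq {n : ℕ} (x : Fin n → ℕ) (r : ℕ) :
    ∃ A : Finset (Fin n), #A ≤ r ∧ topSum x r = ∑ i ∈ A, x i := by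
  set c := (List.finRange n).insertionSort (fun i j => x j ≤ x i) with hc
  have hnd : (c.take r).Nodup :=
    ((List.perm_insertionSort _ _).nodup_iff.2 (List.nodup_finRange n)).sublist
      (List.take_sublist _ _)
  have hmap : (List.ofFn x).insertionSort (fun a b => b ≤ a) = c.map x := by
    rw [List.ofFn_eq_map, hc]
    exact (List.map_insertionSort _ _ x _ fun _ _ _ _ => Iff.rfl).symm
  refine ⟨(c.take r).toFinset, ?_, ?_⟩
  · exact (List.toFinset_card_le _).trans (List.length_take_le _ _)
  · rw [List.sum_toFinset _ hnd, topSum, hmap, List.map_take]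

/-! ### Sorting the classes by their profits -/

variable (I : GAPInstance)

/-- A common denominator of the profits. -/
def denom : ℕ := ∏ i ∈ range I.M, I.initialMemory 4 i

/-- The profit of class `i`, multiplied by the common denominator. -/
def price (i : ℕ) : ℕ := I.initialMemory 3 i * (I.denom / I.initialMemory 4 i)

/-- Class `i` precedes class `j`: it has a larger profit, or the same and a smaller number. -/
def Precedes (i j : ℕ) : Prop := I.price j < I.price i ∨ (I.price i = I.price j ∧ i < j)

instance (i j : ℕ) : Decidable (I.Precedes i j) := by unfold Precedes; infer_instance

/-- The position of class `j` in the order of nonincreasing profits. -/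
def rank (j : ℕ) : ℕ := ∑ i ∈ range I.M, if I.Precedes i j then 1 else 0

/-- The class at position `a` in the order of nonincreasing profits. -/
def ord (a : ℕ) : ℕ := ∑ j ∈ range I.M, if I.rank j = a then j else 0

/-- The largest size of class `i` in an allocation, which is `0` if the class cannot be used. -/
def maxSize (i : ℕ) : ℕ :=
  if I.initialMemory 1 i ≤ min (I.initialMemory 2 i) (I.initialMemory 5 0) then
    min (I.initialMemory 2 i) (I.initialMemory 5 0) else 0

/-- The largest profit of a single class. -/
def maxSingle : ℕ := (range I.M).sup fun i => I.price i * I.maxSize i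

/-- The number `c` if it is below `v`, and `0` otherwise. -/
def below (v c : ℕ) : ℕ := if c < v then c else 0

/-- The maximum of `v / 2` and all bounds below `v` of the first `i` classes. -/
def nextSize (v i : ℕ) : ℕ :=
  max (v / 2) ((range i).sup fun k =>
    max (below v (I.initialMemory 1 k)) (below v (I.initialMemory 2 k)))

/-- The sizes that the dynamic program considers. -/
def sizes : ℕ → ℕ
  | 0 => I.initialMemory 5 0
  | t + 1 => I.nextSize (sizes t) I.M

/-- A number of steps after which the sizes have reached `0`. -/
def rounds : ℕ := 2 * I.M + ((I.initialMemory 5 0).size + 1)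

/-- The data of the dynamic program. -/
def sorted (E : ℕ) : SortedInstance where
  m := I.M
  lo a := I.initialMemory 1 (I.ord a)
  up a := I.initialMemory 2 (I.ord a)
  pr a := I.price (I.ord a)
  B := I.targetSum
  v := I.sizes
  T := I.rounds
  q a x := I.price (I.ord a) * x * I.M * E / I.maxSingle

section input

@[simp] theorem initialMemory_lower (i : Fin I.M) : I.initialMemory 1 i = I.lower i := by
  simp [initialMemory, input]

@[simp] theorem initialMemory_upper (i : Fin I.M) : I.initialMemory 2 i = I.upper i := by
  simp [initialMemory, input]

@[simp] theorem initialMemory_num (i : Fin I.M) : I.initialMemory 3 i = (I.profit i).num := by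
  simp [initialMemory, input]

@[simp] theorem initialMemory_den (i : Fin I.M) : I.initialMemory 4 i = (I.profit i).den := by
  simp [initialMemory, input]

theorem targetSum_succ (r : ℕ) : I.targetSum (r + 1) = I.targetSum r + I.initialMemory 5 r := by
  unfold targetSum
  by_cases h : r < I.K
  · rw [List.sum_take_succ _ _ (by simpa using h)]
    simp [initialMemory, input, h]
  · have h1 : (List.ofFn I.target).length ≤ r := by simpa using h
    rw [List.take_of_length_le h1, List.take_of_length_le (h1.trans (Nat.le_succ r))]
    simp [initialMemory, input, h]

theorem targetSum_zero : I.targetSum 0 = 0 := by simp [targetSum]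

theorem targetSum_one : I.targetSum 1 = I.initialMemory 5 0 := by
  rw [targetSum_succ, targetSum_zero, zero_add]

theorem targetSum_mono : Monotone I.targetSum :=
  monotone_nat_of_le_succ fun r => by rw [targetSum_succ]; exact Nat.le_add_right _ _

end input

theorem rank_eq_card (j : ℕ) : I.rank j = #{i ∈ range I.M | I.Precedes i j} := by
  rw [rank, card_filter]

variable {I}

theorem rank_lt_rank {i j : ℕ} (hi : i < I.M) (h : I.Precedes i j) : I.rank i < I.rank j := by
  rw [rank_eq_card, rank_eq_card]
  refine card_lt_card ((ssubset_iff_of_subset fun k hk => ?_).2 ⟨i, ?_, ?_⟩)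
  · rw [mem_filter] at hk ⊢
    refine ⟨hk.1, ?_⟩
    have := hk.2
    unfold Precedes at this h ⊢
    omega
  · simp [hi, h]
  · rw [mem_filter]
    unfold Precedes
    omega

theorem rank_lt {j : ℕ} (hj : j < I.M) : I.rank j < I.M := by
  rw [rank_eq_card]
  conv_rhs => rw [← card_range I.M]
  refine card_lt_card ((ssubset_iff_of_subset (filter_subset _ _)).2 ⟨j, ?_, ?_⟩)
  · simp [hj]
  · rw [mem_filter]
    unfold Precedes
    omega

theorem rank_injOn {i j : ℕ} (hi : i < I.M) (hj : j < I.M) (h : I.rank i = I.rank j) :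
    i = j := by
  by_contra hne
  have : I.Precedes i j ∨ I.Precedes j i := by unfold Precedes; omega
  rcases this with h1 | h1
  · exact (rank_lt_rank hi h1).ne h
  · exact (rank_lt_rank hj h1).ne' h

theorem ord_rank {j : ℕ} (hj : j < I.M) : I.ord (I.rank j) = j := by
  rw [ord, sum_eq_single j]
  · simp
  · intro k hk hkj
    rw [if_neg]
    exact fun h => hkj (rank_injOn (mem_range.1 hk) hj h)
  · intro h
    exact absurd (mem_range.2 hj) h

theorem exists_rank_eq {a : ℕ} (ha : a < I.M) : ∃ j < I.M, I.rank j = a := by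
  have hinj : Function.Injective fun j : Fin I.M => (⟨I.rank j, rank_lt j.2⟩ : Fin I.M) := by
    intro i j h
    exact Fin.ext (rank_injOn i.2 j.2 (Fin.mk.inj_iff.1 h))
  obtain ⟨j, hj⟩ := (Finite.injective_iff_surjective.1 hinj) ⟨a, ha⟩
  exact ⟨j, j.2, Fin.mk.inj_iff.1 hj⟩

theorem ord_lt {a : ℕ} (ha : a < I.M) : I.ord a < I.M := by
  obtain ⟨j, hj, rfl⟩ := exists_rank_eq ha
  rwa [ord_rank hj]

theorem rank_ord {a : ℕ} (ha : a < I.M) : I.rank (I.ord a) = a := by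
  obtain ⟨j, hj, rfl⟩ := exists_rank_eq ha
  rw [ord_rank hj]

theorem price_ord_anti {a b : ℕ} (hab : a ≤ b) (hb : b < I.M) :
    I.price (I.ord b) ≤ I.price (I.ord a) := by
  by_contra hcon
  have := rank_lt_rank (ord_lt hb) (show I.Precedes (I.ord b) (I.ord a) from .inl (by omega))
  rw [rank_ord hb, rank_ord (hab.trans_lt hb)] at this
  omega

theorem below_le_pred (v c : ℕ) : below v c ≤ v - 1 := by unfold below; split_ifs <;> omega

theorem nextSize_le (v i : ℕ) : I.nextSize v i ≤ v - 1 := by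
  refine max_le (by omega) (Finset.sup_le fun k _ => max_le ?_ ?_) <;> exact below_le_pred _ _

theorem le_nextSize {v c i : ℕ} (hi : i < I.M)
    (hc : c = I.initialMemory 1 i ∨ c = I.initialMemory 2 i) (hcv : c < v) :
    c ≤ I.nextSize v I.M := by
  refine le_max_of_le_right (le_trans ?_ (Finset.le_sup (mem_range.2 hi)))
  rcases hc with rfl | rfl
  · exact le_max_of_le_left (by simp [below, hcv])
  · exact le_max_of_le_right (by simp [below, hcv])

variable (I) in
/-- The number of bounds of classes that are below `v`. -/
def boundsBelow (v : ℕ) : ℕ :=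
  #{i ∈ range I.M | I.initialMemory 1 i < v} + #{i ∈ range I.M | I.initialMemory 2 i < v}

/-- Each step to the next size passes a bound of a class or shortens the number. -/
theorem boundsBelow_add_size_lt {v : ℕ} (hv : 0 < v) :
    I.boundsBelow (I.nextSize v I.M) + (I.nextSize v I.M).size < I.boundsBelow v + v.size := by
  have hlt : I.nextSize v I.M < v := by have := nextSize_le (I := I) v I.M; omega
  have hmono : ∀ b, #{i ∈ range I.M | I.initialMemory b i < I.nextSize v I.M} ≤
      #{i ∈ range I.M | I.initialMemory b i < v} := fun b =>
    card_le_card (monotone_filter_right _ fun i hi h => h.trans hlt)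
  have hsize := Nat.size_le_size hlt.le
  have hstrict : ∀ b, ∀ i < I.M, I.initialMemory b i = I.nextSize v I.M →
      #{i ∈ range I.M | I.initialMemory b i < I.nextSize v I.M} <
      #{i ∈ range I.M | I.initialMemory b i < v} := fun b i hi h =>
    card_lt_card ((ssubset_iff_of_subset (monotone_filter_right _ fun i _ h => h.trans hlt)).2
      ⟨i, by simp [hi, h, hlt], by simp [h]⟩)
  have h1 := hmono 1
  have h2 := hmono 2
  simp only [boundsBelow]
  by_cases hhalf : I.nextSize v I.M = v / 2
  · have : (v / 2).size < v.size := by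
      have h3 := Nat.size_pos.2 hv
      refine lt_of_le_of_lt (Nat.size_le.2 ?_) (Nat.sub_one_lt h3.ne')
      have h4 := Nat.lt_size_self v
      rw [show v.size = v.size - 1 + 1 by omega, pow_succ] at h4
      omega
    rw [hhalf] at h1 h2 ⊢
    omega
  · have hM : (range I.M).Nonempty := by
      by_contra hcon
      rw [not_nonempty_iff_eq_empty] at hcon
      simp [nextSize, hcon] at hhalf
    obtain ⟨k, hk, hsup⟩ := exists_mem_eq_sup _ hM fun k =>
      max (below v (I.initialMemory 1 k)) (below v (I.initialMemory 2 k))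
    have hk' := mem_range.1 hk
    have heq : I.nextSize v I.M = I.initialMemory 1 k ∨ I.nextSize v I.M = I.initialMemory 2 k := by
      have h3 : I.nextSize v I.M = max (v / 2) (max (below v (I.initialMemory 1 k))
        (below v (I.initialMemory 2 k))) := by rw [nextSize, hsup]
      unfold below at h3
      split_ifs at h3 <;> omega
    rcases heq with h | h
    · have := hstrict 1 k hk' h.symm
      omega
    · have := hstrict 2 k hk' h.symm
      omega

theorem sizes_rounds : I.sizes I.rounds = 0 := by
  by_contra hne
  have hanti : Antitone I.sizes := antitone_nat_of_succ_le fun t =>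
    (nextSize_le _ _).trans (Nat.sub_le _ _)
  have key : ∀ t ≤ I.rounds, I.boundsBelow (I.sizes t) + (I.sizes t).size + t ≤
      2 * I.M + (I.initialMemory 5 0).size := by
    intro t
    induction t with
    | zero =>
      intro _
      have h : ∀ b, #{i ∈ range I.M | I.initialMemory b i < I.sizes 0} ≤ I.M := fun b =>
        (card_filter_le _ _).trans (card_range _).le
      have := h 1
      have := h 2
      simp only [boundsBelow, sizes] at *
      omega
    | succ t ih =>
      intro ht
      have h1 := ih (by omega)
      have h2 : 0 < I.sizes t := by
        have := hanti ht
        have := hanti (show t ≤ t + 1 by omega)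
        omega
      have h3 := boundsBelow_add_size_lt (I := I) h2
      simp only [sizes]
      omega
  have := key _ le_rfl
  simp only [rounds] at this
  omega

theorem sorted_valid (E : ℕ) : (I.sorted E).Valid where
  lo_pos a ha := by
    have := ord_lt (I := I) ha
    have h := I.initialMemory_lower ⟨_, this⟩
    simp only [sorted] at h ⊢
    rw [h]
    exact I.lower_pos _
  pr_anti a b hab hb := price_ord_anti hab hb
  B_mono := I.targetSum_mono
  v_zero := I.targetSum_one.symm
  v_succ_le t := nextSize_le _ _
  half_le t := le_max_left _ _
  lo_le t a ha h := le_nextSize (ord_lt ha) (.inl rfl) h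
  up_le t a ha h := le_nextSize (ord_lt ha) (.inr rfl) h
  v_T := sizes_rounds
  q_zero a := by simp [sorted]

/-! ### Allocations in the order of nonincreasing profits -/

variable (I) in
/-- The allocation of the instance that corresponds to an allocation of the sorted classes. -/
def unsort (z : ℕ → ℕ) : Fin I.M → ℕ := fun i => z (I.rank i)

theorem sum_image_rank (A : Finset (Fin I.M)) (f : ℕ → ℕ) :
    ∑ a ∈ A.image (fun i : Fin I.M => I.rank i), f a = ∑ i ∈ A, f (I.rank i) :=
  sum_image fun i _ j _ h => Fin.ext (rank_injOn i.2 j.2 h)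

theorem card_image_rank (A : Finset (Fin I.M)) : #(A.image fun i : Fin I.M => I.rank i) = #A :=
  card_image_of_injective _ fun i j h => Fin.ext (rank_injOn i.2 j.2 h)

theorem exists_image_rank_eq {A : Finset ℕ} (hA : A ⊆ range I.M) :
    ∃ A' : Finset (Fin I.M), A'.image (fun i : Fin I.M => I.rank i) = A := by
  refine ⟨univ.filter fun i : Fin I.M => I.rank i ∈ A, ?_⟩
  ext a
  simp only [mem_image, mem_filter, mem_univ, true_and]
  constructor
  · rintro ⟨i, hi, rfl⟩
    exact hi
  · intro ha
    obtain ⟨j, hj, rfl⟩ := exists_rank_eq (mem_range.1 (hA ha))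
    exact ⟨⟨j, hj⟩, ha, rfl⟩

theorem feasible_unsort_iff (E : ℕ) {z : ℕ → ℕ} (hz : ∀ a, I.M ≤ a → z a = 0) :
    I.Feasible (I.unsort z) ↔ (I.sorted E).Feas z := by
  constructor
  · rintro ⟨hb, hs⟩
    refine ⟨fun a ha => ?_, hz, fun A hA => ?_⟩
    · have := hb ⟨I.ord a, ord_lt ha⟩
      rw [← initialMemory_lower, ← initialMemory_upper] at this
      simp only [unsort, rank_ord ha] at this
      exact this
    · obtain ⟨A', rfl⟩ := exists_image_rank_eq hA
      rw [sum_image_rank, card_image_rank]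
      exact (sum_le_topSum (I.unsort z) le_rfl).trans (hs _)
  · intro h
    refine ⟨fun i => ?_, fun r => ?_⟩
    · have := h.bounds (I.rank i) (rank_lt i.2)
      simpa [sorted, unsort, ord_rank i.2] using this
    · obtain ⟨A, hA, hsum⟩ := exists_topSum_eq (I.unsort z) r
      rw [hsum]
      have := h.sum_le (A.image fun i : Fin I.M => I.rank i) fun a ha => by
        obtain ⟨i, -, rfl⟩ := mem_image.1 ha
        exact mem_range.2 (rank_lt i.2)
      rw [sum_image_rank, card_image_rank] at this
      exact this.trans (I.targetSum_mono hA)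

theorem exists_unsort_eq (x : Fin I.M → ℕ) :
    ∃ z, (∀ a, I.M ≤ a → z a = 0) ∧ I.unsort z = x := by
  refine ⟨fun a => if h : a < I.M then x ⟨I.ord a, ord_lt h⟩ else 0, fun a ha => ?_, ?_⟩
  · simp [not_lt.2 ha]
  · funext i
    simp [unsort, rank_lt i.2, ord_rank i.2]

theorem denom_pos : 0 < I.denom := prod_pos fun i hi => by
  rw [show i = ((⟨i, mem_range.1 hi⟩ : Fin I.M) : ℕ) from rfl, initialMemory_den]
  exact (I.profit _).den_pos

theorem price_eq (i : Fin I.M) : (I.price i : ℚ≥0) = I.profit i * I.denom := by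
  have hdvd : (I.profit i).den ∣ I.denom := by
    rw [← initialMemory_den]
    exact dvd_prod_of_mem _ (mem_range.2 i.2)
  have hne : ((I.profit i).den : ℚ≥0) ≠ 0 := by exact_mod_cast (I.profit i).den_ne_zero
  rw [price, initialMemory_num, initialMemory_den, Nat.cast_mul, Nat.cast_div hdvd hne]
  conv_rhs => rw [← NNRat.num_div_den (I.profit i)]
  ring

theorem profit_sorted (E : ℕ) (z : ℕ → ℕ) :
    ((I.sorted E).profit z : ℚ≥0) = I.totalProfit (I.unsort z) * I.denom := by
  have h : (univ : Finset (Fin I.M)).image (fun i : Fin I.M => I.rank i) = range I.M := by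
    ext a
    simp only [mem_image, mem_univ, true_and, mem_range]
    exact ⟨by rintro ⟨i, rfl⟩; exact rank_lt i.2,
      fun ha => ⟨⟨I.ord a, ord_lt ha⟩, rank_ord ha⟩⟩
  have h1 : (I.sorted E).profit z = ∑ i : Fin I.M, I.price i * z (I.rank i) := by
    rw [SortedInstance.profit, show (I.sorted E).m = I.M from rfl, ← h, sum_image_rank]
    exact sum_congr rfl fun i _ => by simp [sorted, ord_rank i.2]
  rw [h1, totalProfit, sum_mul]
  push_cast
  exact sum_congr rfl fun i _ => by rw [price_eq, unsort]; ring

theorem price_mul_le_maxSingle (E : ℕ) {z : ℕ → ℕ} (hz : (I.sorted E).Feas z) {a : ℕ}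
    (ha : a < I.M) : (I.sorted E).pr a * z a ≤ I.maxSingle := by
  have h1 : I.price (I.ord a) * I.maxSize (I.ord a) ≤ I.maxSingle :=
    Finset.le_sup (f := fun i => I.price i * I.maxSize i) (mem_range.2 (ord_lt ha))
  refine le_trans (Nat.mul_le_mul_left _ ?_) h1
  have h2 := hz.bounds a ha
  have h3 : z a ≤ I.initialMemory 5 0 := by
    rw [← targetSum_one]; exact hz.le_B_one a
  simp only [sorted] at h2
  unfold maxSize
  split_ifs <;> omega

theorem exists_maxSingle_le_profit (E : ℕ) :
    ∃ y, (I.sorted E).Feas y ∧ I.maxSingle ≤ (I.sorted E).profit y := by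
  rcases Nat.eq_zero_or_pos I.maxSingle with h0 | h0
  · exact ⟨_, SortedInstance.feas_zero, by omega⟩
  have hM : (range I.M).Nonempty := by
    by_contra hcon
    rw [not_nonempty_iff_eq_empty] at hcon
    simp [maxSingle, hcon] at h0
  obtain ⟨i, hi, hsup⟩ := exists_mem_eq_sup _ hM fun i => I.price i * I.maxSize i
  rw [mem_range] at hi
  rw [maxSingle, hsup] at h0
  have hpos : 0 < I.maxSize i := Nat.pos_of_mul_pos_left h0
  have hcap : I.initialMemory 1 i ≤ I.maxSize i ∧ I.maxSize i ≤ I.initialMemory 2 i ∧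
      I.maxSize i ≤ I.initialMemory 5 0 := by
    unfold maxSize at hpos ⊢
    split_ifs at hpos ⊢ with h
    · omega
    · omega
  refine ⟨Function.update (fun _ => 0) (I.rank i) (I.maxSize i),
    SortedInstance.feas_zero.update (sorted_valid E) (rank_lt hi) rfl ?_ ?_ (by simp) ?_, ?_⟩
  · simpa [sorted, ord_rank hi] using hcap.1
  · simpa [sorted, ord_rank hi] using hcap.2.1
  · simpa [SortedInstance.total, SortedInstance.count, sorted, targetSum_one] using hcap.2.2
  · rw [maxSingle, hsup, SortedInstance.profit,
      SortedInstance.sum_update_of_eq_zero (A := range (I.sorted E).m)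
        (fun a y => (I.sorted E).pr a * y)
        (z := fun _ => 0) (mem_range.2 (rank_lt hi)) rfl (by simp)]
    simp [sorted, ord_rank hi]

end GAPInstance

/-! ### The program -/

namespace GAPInstance

open Finset RAM RAM.Expr

section program

variable (E : ℕ)

/-- The number of classes. -/
def classesE : Expr := read 0 (const 0)

/-- The first entry of the target vector. -/
def firstE : Expr := read 5 (const 0)

/-- The maximal size of class `i`. -/
def maxSizeE (i : Expr) : Expr :=
  ite (le (read 1 i) (min (read 2 i) firstE)) (min (read 2 i) firstE) (const 0)

/-- The last entry of row `i` of a table with rows of length `w`. -/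
def rowEndE (b : ℕ) (i w : Expr) : Expr := read b (add (mul i w) (sub w (const 1)))

/-- The value `1` or `0` according to whether class `i` precedes class `j`. -/
def precedesE (i j : Expr) : Expr :=
  ite (or (lt (read 10 j) (read 10 i)) (and (eq (read 10 i) (read 10 j)) (lt i j)))
    (const 1) (const 0)

/-- The value of `c` if it is below that of `v`, and `0` otherwise. -/
def belowE (v c : Expr) : Expr := ite (lt c v) c (const 0)

/-- The number of sizes. The counter of bank `8` holds one plus the bit length of the first entry of
the target vector, because the table in that bank halves this entry until it is `0`. -/
def roundsE : Expr := add (mul (const 2) classesE) (counter 108)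

/-- The number of classes plus one. -/
def widthE : Expr := add classesE (const 1)

/-- The number of scaled profits that are considered. -/
def profitsE : Expr := add (mul (mul classesE classesE) (const E)) (const 1)

/-- The address of the entry of the dynamic program for step `τ` and key `a, r, p`. -/
def addrE (τ a r p : Expr) : Expr :=
  add (mul (add (mul (add (mul τ widthE) a) widthE) r) (profitsE E)) p

/-- A strict upper bound on the total of an allocation. -/
def capE : Expr := add (read 7 classesE) (const 1)

/-- The code after `x` items of the `r`-th class `j` have been added, or `0`. -/
def extendE (c x j r : Expr) : Expr :=
  ite (and c (le (add (sub capE (div c (read 15 classesE))) x) (read 7 (sub r (const 1)))))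
    (add (sub c (mul x (read 15 classesE))) (mul x (read 15 j))) (const 0)

/-- The scaled profit of `x` items of class `i`. -/
def scaledE (i x : Expr) : Expr :=
  div (mul (mul (mul (read 10 i) x) classesE) (const E)) (read 11 (sub classesE (const 1)))

/-- The entry of the dynamic program for the key `a, r, p` after the step `τ` for the class `i`
at position `j` and the size `x`. -/
def stepE (τ a r p j i x : Expr) : Expr :=
  max (max (read 16 (addrE E τ a r p))
      (ite (eq a (add j (const 1))) (read 16 (addrE E τ j r p)) (const 0)))
    (ite (and (le (const 1) r) (and (le (scaledE E i x) p) (and (le (read 1 i) x)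
        (le x (read 2 i)))))
      (max
        (ite (eq a (add j (const 1)))
          (extendE (read 16 (addrE E τ j (sub r (const 1)) (sub p (scaledE E i x)))) x j r)
          (const 0))
        (ite (or (and (lt j a) (eq x (read 2 i))) (and (le a j) (eq x (read 1 i))))
          (extendE (read 16 (addrE E τ a (sub r (const 1)) (sub p (scaledE E i x)))) x j r)
          (const 0)))
      (const 0))

/-- The scaled profit of the entry with address `n`. -/
def profitOfE (n : Expr) : Expr := mod n (profitsE E)

/-- The number of used classes of the entry with address `n`. -/
def countOfE (n : Expr) : Expr := mod (div n (profitsE E)) widthE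

/-- The position of the threshold of the entry with address `n`. -/
def thresholdOfE (n : Expr) : Expr := mod (div (div n (profitsE E)) widthE) widthE

/-- The step of the entry with address `n`. -/
def stepOfE (n : Expr) : Expr := div (div (div n (profitsE E)) widthE) widthE

/-- The entry of the dynamic program with address `n`; `τ` is the step before it. -/
def bestE (n τ : Expr) : Expr :=
  ite (stepOfE E n)
    (stepE E τ (thresholdOfE E n) (countOfE E n) (profitOfE E n) (mod τ classesE)
      (rowEndE 13 (mod τ classesE) classesE) (rowEndE 14 (div τ classesE) widthE))
    (ite n (const 0) (mul capE (read 15 classesE)))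

/-- The number of keys of the dynamic program. -/
def keysE : Expr := mul (mul widthE widthE) (profitsE E)

/-- The final entry of the dynamic program for the key with number `n`. -/
def finalE (n : Expr) : Expr :=
  read 16 (addrE E (mul roundsE classesE) (const 0) (const 0) n)

/-- The tests of the loops that fill the tables. -/
def testE : ℕ → Expr
  | 7 => sub widthE (counter 107)
  | 8 => add (Expr.not (counter 108)) (read 8 (sub (counter 108) (const 1)))
  | 9 => sub widthE (counter 109)
  | 10 => sub classesE (counter 110)
  | 11 => sub classesE (counter 111)
  | 12 => sub (mul classesE classesE) (counter 112)
  | 13 => sub (mul classesE classesE) (counter 113)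
  | 14 => sub (mul roundsE widthE) (counter 114)
  | 15 => sub widthE (counter 115)
  | 16 => sub (mul (add (mul roundsE classesE) (const 1)) (keysE E)) (counter 116)
  | 17 => sub (keysE E) (counter 117)
  | _ => const 0

/-- The entry of the table in bank `k` that is computed next. In the first round, the previous entry
is read from cell `0` of the table itself, which is still `0`; where the first entry has to be `1`,
it is supplied by the negation of the counter. -/
def entryE : ℕ → Expr
  | 7 => add (read 7 (sub (counter 107) (const 1))) (read 5 (counter 107))
  | 8 => ite (counter 108) (div (read 8 (sub (counter 108) (const 1))) (const 2)) firstE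
  | 9 => add (Expr.not (counter 109)) (mul (read 9 (sub (counter 109) (const 1)))
      (read 4 (sub (counter 109) (const 1))))
  | 10 => mul (read 3 (counter 110)) (div (read 9 classesE) (read 4 (counter 110)))
  | 11 => max (read 11 (sub (counter 111) (const 1)))
      (mul (read 10 (counter 111)) (maxSizeE (counter 111)))
  | 12 => add (ite (mod (counter 112) classesE) (read 12 (sub (counter 112) (const 1))) (const 0))
      (precedesE (mod (counter 112) classesE) (div (counter 112) classesE))
  | 13 => add (ite (mod (counter 113) classesE) (read 13 (sub (counter 113) (const 1))) (const 0))
      (ite (eq (rowEndE 12 (mod (counter 113) classesE) classesE) (div (counter 113) classesE))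
        (mod (counter 113) classesE) (const 0))
  | 14 => ite (div (counter 114) widthE)
      (ite (mod (counter 114) widthE)
        (max (read 14 (sub (counter 114) (const 1)))
          (max
            (belowE (rowEndE 14 (sub (div (counter 114) widthE) (const 1)) widthE)
              (read 1 (sub (mod (counter 114) widthE) (const 1))))
            (belowE (rowEndE 14 (sub (div (counter 114) widthE) (const 1)) widthE)
              (read 2 (sub (mod (counter 114) widthE) (const 1))))))
        (div (rowEndE 14 (sub (div (counter 114) widthE) (const 1)) widthE) (const 2)))
      firstE
  | 15 => add (Expr.not (counter 115)) (mul (read 15 (sub (counter 115) (const 1)))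
      (add firstE (const 1)))
  | 16 => bestE E (counter 116) (sub (stepOfE E (counter 116)) (const 1))
  | 17 => max (read 17 (sub (counter 117) (const 1)))
      (ite (finalE E (counter 117))
        (add (mul (mod (counter 117) (profitsE E)) (mul (add capE (const 1)) (read 15 classesE)))
          (finalE E (counter 117)))
        (const 0))
  | _ => const 0

/-- The program that fills `n` tables, which are in the banks from `7` on. -/
def tablesProgram : ℕ → Program
  | 0 => .skip
  | n + 1 => .seq (tablesProgram n) (fill (7 + n) (100 + (7 + n)) (testE E (7 + n)) (entryE E (7 + n)))

/-- The test of the loop that writes the allocation. -/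
def outputTestE : Expr := sub classesE (counter 106)

/-- The entry of the allocation that is written next. -/
def outputE : Expr :=
  mod (div (read 17 (sub (keysE E) (const 1)))
    (read 15 (rowEndE 12 (counter 106) classesE))) (add firstE (const 1))

/-- The approximation algorithm. -/
def program : Program := .seq (tablesProgram E 11) (fill 6 106 outputTestE (outputE E))

end program

/-! ### The contents of the tables -/

section tables

variable (I : GAPInstance) (E : ℕ)

/-- The number of scaled profits that are considered. -/
def profits : ℕ := I.M * I.M * E + 1

/-- The number of keys of the dynamic program. -/
def keys : ℕ := (I.M + 1) * (I.M + 1) * I.profits E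

/-- The address of the entry of the dynamic program for step `τ` and key `a, r, p`. -/
def addr (τ a r p : ℕ) : ℕ := ((τ * (I.M + 1) + a) * (I.M + 1) + r) * I.profits E + p

/-- The entry of the dynamic program with address `n`. -/
def bestAt (n : ℕ) : ℕ :=
  (I.sorted E).best (n / I.profits E / (I.M + 1) / (I.M + 1))
    (n / I.profits E / (I.M + 1) % (I.M + 1)) (n / I.profits E % (I.M + 1)) (n % I.profits E)

/-- The first `i` steps of the computation of the size with number `t`. -/
def partialSize : ℕ → ℕ → ℕ
  | 0, _ => I.initialMemory 5 0
  | t + 1, i => I.nextSize (I.sizes t) i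

/-- A number that is larger than all codes. -/
def codeBound : ℕ := ((I.sorted E).cap + 1) * (I.sorted E).base ^ I.M

/-- The final entry with number `n`, preceded by its scaled profit. -/
def candidate (n : ℕ) : ℕ :=
  if I.bestAt E (I.addr E (I.rounds * I.M) 0 0 n) ≠ 0 then
    n % I.profits E * I.codeBound E + I.bestAt E (I.addr E (I.rounds * I.M) 0 0 n) else 0

/-- The table in bank `k`. Banks `12`, `13` and `14` consist of rows, of length `M`, `M` and `M + 1`,
of partial results: the last entries of the rows are the values of `rank`, `ord` and `sizes`. -/
def table : ℕ → ℕ → ℕ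
  | 7 => fun n => I.targetSum (n + 1)
  | 8 => fun n => I.initialMemory 5 0 / 2 ^ n
  | 9 => fun n => ∏ i ∈ range n, I.initialMemory 4 i
  | 10 => I.price
  | 11 => fun n => (range (n + 1)).sup fun i => I.price i * I.maxSize i
  | 12 => fun n => ∑ i ∈ range (n % I.M + 1), if I.Precedes i (n / I.M) then 1 else 0
  | 13 => fun n => ∑ j ∈ range (n % I.M + 1), if I.rank j = n / I.M then j else 0
  | 14 => fun n => I.partialSize (n / (I.M + 1)) (n % (I.M + 1))
  | 15 => fun n => (I.sorted E).base ^ n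
  | 16 => I.bestAt E
  | 17 => fun n => (range (n + 1)).sup (I.candidate E)
  | _ => fun _ => 0

/-- The length of the table in bank `k`. -/
def len : ℕ → ℕ
  | 7 => I.M + 1
  | 8 => (I.initialMemory 5 0).size + 1
  | 9 => I.M + 1
  | 10 => I.M
  | 11 => I.M
  | 12 => I.M * I.M
  | 13 => I.M * I.M
  | 14 => I.rounds * (I.M + 1)
  | 15 => I.M + 1
  | 16 => (I.rounds * I.M + 1) * I.keys E
  | 17 => I.keys E
  | _ => 0

/-- The memory `s` contains the input and the tables in the banks below `k`. -/
structure Filled (s : Memory) (k : ℕ) : Prop where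
  input : ∀ b < 6, s b = I.initialMemory b
  table_eq : ∀ b, 7 ≤ b → b < k → ∀ a < I.len E b, s b a = I.table E b a
  len_eq : ∀ b, 7 ≤ b → b < k → s (100 + b) 0 = I.len E b

/-- The memory `s` contains, in addition, the first `n` entries of the table in bank `k`. -/
structure Filling (s : Memory) (k n : ℕ) : Prop extends Filled I E s k where
  entry_eq : ∀ a < n, s k a = I.table E k a
  entry_zero : ∀ a, n ≤ a → s k a = 0
  counter_eq : s (100 + k) 0 = n

/-- The loop for bank `k` computes the table in that bank. -/
def Computes (k : ℕ) : Prop :=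
  (∀ s n, n < I.len E k → I.Filling E s k n →
    (testE E k).eval s ≠ 0 ∧ (entryE E k).eval s = I.table E k n) ∧
  ∀ s, I.Filling E s k (I.len E k) → (testE E k).eval s = 0

end tables

end GAPInstance

/-! ### The program computes the tables -/

namespace GAPInstance

open Finset RAM RAM.Expr

variable {I : GAPInstance} {E : ℕ} {s : Memory} {k n : ℕ}

theorem Filled.eval_classesE (h : I.Filled E s k) : classesE.eval s = I.M := by
  rw [classesE, eval_read, h.input 0 (by decide)]
  rfl

theorem Filled.eval_firstE (h : I.Filled E s k) : firstE.eval s = I.initialMemory 5 0 := by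
  simp [firstE, Expr.eval, h.input 5 (by decide)]

theorem Filled.eval_widthE (h : I.Filled E s k) : widthE.eval s = I.M + 1 := by
  rw [widthE, eval_add, h.eval_classesE, eval_const]

theorem Filled.eval_roundsE (h : I.Filled E s k) (hk : 8 < k) : roundsE.eval s = I.rounds := by
  rw [roundsE, eval_add, eval_mul, h.eval_classesE, eval_counter, eval_const,
    show s 108 0 = _ from h.len_eq 8 (by decide) hk]
  rfl

theorem Filled.eval_profitsE (h : I.Filled E s k) : (profitsE E).eval s = I.profits E := by
  rw [profitsE, eval_add, eval_mul, eval_mul, h.eval_classesE, eval_const, eval_const, profits]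

theorem Filled.eval_keysE (h : I.Filled E s k) : (keysE E).eval s = I.keys E := by
  rw [keysE, eval_mul, eval_mul, h.eval_widthE, h.eval_profitsE, keys]

theorem Filled.eval_maxSizeE (h : I.Filled E s k) (i : Expr) :
    (maxSizeE i).eval s = I.maxSize (i.eval s) := by
  simp only [maxSizeE, eval_ite, eval_le_ne_zero, eval_min, eval_read, h.eval_firstE, eval_const,
    h.input 1 (by decide), h.input 2 (by decide), maxSize]

theorem sup_range_succ (f : ℕ → ℕ) (n : ℕ) :
    (range (n + 1)).sup f = max ((range n).sup f) (f n) := by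
  rw [range_add_one, sup_insert, sup_comm]

theorem computes_targetSum : I.Computes E 7 := by
  refine ⟨fun s n hn h => ?_, fun s h => ?_⟩ <;>
    have hc : s 107 0 = _ := h.counter_eq <;>
    simp only [testE, entryE, table, len, eval_sub, eval_add, eval_read, eval_counter, eval_const,
      h.eval_widthE, hc, h.input 5 (by decide)]
  · simp only [len] at hn
    refine ⟨by omega, ?_⟩
    rw [targetSum_succ]
    rcases n with _ | n
    · rw [h.entry_zero _ le_rfl, targetSum_zero]
    · rw [Nat.add_sub_cancel, h.entry_eq _ (Nat.lt_succ_self _)]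
      rfl
  · omega

theorem computes_halves : I.Computes E 8 := by
  refine ⟨fun s n hn h => ?_, fun s h => ?_⟩ <;>
    have hc : s 108 0 = _ := h.counter_eq <;>
    simp only [testE, entryE, table, len, eval_sub, eval_add, eval_read, eval_counter, eval_const,
      eval_not, eval_ite, eval_div, h.eval_firstE, hc]
  · simp only [len] at hn
    rcases n with _ | n
    · simp
    · rw [Nat.add_sub_cancel, h.entry_eq _ (Nat.lt_succ_self _), if_neg (Nat.succ_ne_zero n),
        if_pos (Nat.succ_ne_zero n)]
      simp only [table, Nat.div_div_eq_div_mul, ← pow_succ, and_true]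
      have : 2 ^ n ≤ I.initialMemory 5 0 := Nat.lt_size.1 (by omega)
      have := Nat.div_pos this (by positivity)
      omega
  · rw [Nat.add_sub_cancel, h.entry_eq _ (Nat.lt_succ_self _)]
    simp [table, Nat.div_eq_of_lt (Nat.lt_size_self _)]

theorem computes_denominators : I.Computes E 9 := by
  refine ⟨fun s n hn h => ?_, fun s h => ?_⟩ <;>
    have hc : s 109 0 = _ := h.counter_eq <;>
    simp only [testE, entryE, table, len, eval_sub, eval_add, eval_read, eval_counter, eval_const,
      eval_not, eval_mul, h.eval_widthE, hc, h.input 4 (by decide)]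
  · simp only [len] at hn
    refine ⟨by omega, ?_⟩
    rcases n with _ | n
    · simp [h.entry_zero 0 le_rfl]
    · rw [Nat.add_sub_cancel, h.entry_eq _ (Nat.lt_succ_self _), prod_range_succ]
      simp [table]
  · omega

theorem Filled.eval_denom (h : I.Filled E s k) (hk : 9 < k) :
    (read 9 classesE).eval s = I.denom := by
  rw [eval_read, h.eval_classesE, h.table_eq 9 (by decide) hk _ (by simp [len])]
  rfl

theorem computes_price : I.Computes E 10 := by
  refine ⟨fun s n hn h => ?_, fun s h => ?_⟩ <;>
    have hc : s 110 0 = _ := h.counter_eq <;>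
    simp only [testE, entryE, eval_mul, eval_div, h.eval_denom (by decide)] <;>
    simp only [table, len, eval_sub, eval_read, eval_counter,
      h.eval_classesE, hc, h.input 4 (by decide), h.input 3 (by decide)]
  · simp only [len] at hn
    exact ⟨by omega, rfl⟩
  · omega

theorem Filled.price_eq (h : I.Filled E s k) (hk : 10 < k) {i : ℕ} (hi : i < I.M) :
    s 10 i = I.price i :=
  h.table_eq 10 (by decide) hk i hi

theorem computes_maxSingle : I.Computes E 11 := by
  refine ⟨fun s n hn h => ?_, fun s h => ?_⟩ <;>
    have hc : s 111 0 = _ := h.counter_eq <;>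
    simp only [testE, entryE, table, len, eval_sub, eval_max, eval_read, eval_counter, eval_const,
      eval_mul, h.eval_classesE, hc, h.eval_maxSizeE]
  · simp only [len] at hn
    refine ⟨by omega, ?_⟩
    rw [h.price_eq (by decide) hn, sup_range_succ]
    rcases n with _ | n
    · simp [h.entry_zero 0 le_rfl]
    · rw [Nat.add_sub_cancel, h.entry_eq _ (Nat.lt_succ_self _)]
      rfl
  · omega

theorem Filled.maxSingle_eq (h : I.Filled E s k) (hk : 11 < k) (hM : 0 < I.M) :
    s 11 (I.M - 1) = I.maxSingle := by
  rw [h.table_eq 11 (by decide) hk (I.M - 1) (by simp only [len]; omega)]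
  simp only [table, maxSingle]
  rw [Nat.sub_add_cancel hM]

theorem Filled.eval_precedesE (h : I.Filled E s k) (hk : 10 < k) (i j : Expr)
    (hi : i.eval s < I.M) (hj : j.eval s < I.M) :
    (precedesE i j).eval s = if I.Precedes (i.eval s) (j.eval s) then 1 else 0 := by
  simp only [precedesE, eval_ite, eval_or_ne_zero, eval_and_ne_zero, eval_lt_ne_zero,
    eval_eq_ne_zero, eval_read, h.price_eq hk hi, h.price_eq hk hj, eval_const, Precedes]

/-- Partial sums along the rows of a table with rows of length `w`. -/
theorem ite_add_eq_sum_range {w n x : ℕ} {f : ℕ → ℕ → ℕ} {t : ℕ → ℕ} (hw : 0 < w)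
    (ht : ∀ a < n, t a = ∑ i ∈ range (a % w + 1), f i (a / w)) (hx : x = f (n % w) (n / w)) :
    (if n % w ≠ 0 then t (n - 1) else 0) + x = ∑ i ∈ range (n % w + 1), f i (n / w) := by
  rw [sum_range_succ, hx]
  congr 1
  split_ifs with h
  · have hn : 0 < n := Nat.pos_of_ne_zero fun h0 => h (by simp [h0])
    have h1 := Nat.div_add_mod n w
    have h2 := Nat.mod_lt n hw
    have h3 : n - 1 = w * (n / w) + (n % w - 1) := by omega
    have h4 : (n - 1) / w = n / w := by
      rw [h3, Nat.mul_add_div hw, Nat.div_eq_of_lt (show n % w - 1 < w by omega), add_zero]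
    have h5 : (n - 1) % w = n % w - 1 := by
      rw [h3, Nat.mul_add_mod, Nat.mod_eq_of_lt (by omega)]
    rw [ht _ (by omega), h4, h5, Nat.sub_add_cancel (by omega)]
  · rw [not_not.1 h]
    simp

theorem row_end_div {i w : ℕ} (hw : 0 < w) : (i * w + (w - 1)) / w = i := by
  rw [mul_comm, Nat.mul_add_div hw, Nat.div_eq_of_lt (by omega), add_zero]

theorem row_end_mod {i w : ℕ} (hw : 0 < w) : (i * w + (w - 1)) % w = w - 1 := by
  rw [mul_comm, Nat.mul_add_mod, Nat.mod_eq_of_lt (by omega)]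

theorem row_end_lt {i w l : ℕ} (hw : 0 < w) (hi : i < l) : i * w + (w - 1) < l * w := by
  have := Nat.mul_le_mul_right w (Nat.succ_le_of_lt hi)
  rw [Nat.succ_mul] at this
  omega

theorem computes_precedes : I.Computes E 12 := by
  refine ⟨fun s n hn h => ?_, fun s h => ?_⟩ <;>
    have hc : s 112 0 = _ := h.counter_eq
  · have hn' : n < I.M * I.M := hn
    have hM : 0 < I.M := Nat.pos_of_ne_zero fun h0 => by simp [h0] at hn'
    have h1 : (mod (counter 112) classesE).eval s = n % I.M := by
      rw [eval_mod, eval_counter, hc, h.eval_classesE]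
    have h2 : (div (counter 112) classesE).eval s = n / I.M := by
      rw [eval_div, eval_counter, hc, h.eval_classesE]
    have h3 : n / I.M < I.M := Nat.div_lt_of_lt_mul hn'
    have h4 := Nat.mod_lt n hM
    constructor
    · simp only [testE, eval_sub, eval_mul, h.eval_classesE, eval_counter, hc]
      omega
    · simp only [entryE, eval_add, eval_ite]
      rw [h.eval_precedesE (by decide) _ _ (by omega) (by omega), h1, h2]
      simp only [eval_read, eval_sub, eval_counter, hc, eval_const, table]
      exact ite_add_eq_sum_range hM (f := fun i j => if I.Precedes i j then 1 else 0)
        h.entry_eq rfl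
  · simp only [testE, eval_sub, eval_mul, h.eval_classesE, eval_counter, hc, len, Nat.sub_self]

theorem Filled.eval_rank (h : I.Filled E s k) (hk : 12 < k) (j : Expr) (hj : j.eval s < I.M) :
    (rowEndE 12 j classesE).eval s = I.rank (j.eval s) := by
  have hM : 0 < I.M := by omega
  rw [rowEndE, eval_read, eval_add, eval_mul, eval_sub, h.eval_classesE, eval_const,
    h.table_eq 12 (by decide) hk _ (row_end_lt hM hj)]
  simp only [table, row_end_div hM, row_end_mod hM, Nat.sub_add_cancel hM]
  rfl

theorem computes_ord : I.Computes E 13 := by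
  refine ⟨fun s n hn h => ?_, fun s h => ?_⟩ <;>
    have hc : s 113 0 = _ := h.counter_eq
  · have hn' : n < I.M * I.M := hn
    have hM : 0 < I.M := Nat.pos_of_ne_zero fun h0 => by simp [h0] at hn'
    have h1 : (mod (counter 113) classesE).eval s = n % I.M := by
      rw [eval_mod, eval_counter, hc, h.eval_classesE]
    have h2 : (div (counter 113) classesE).eval s = n / I.M := by
      rw [eval_div, eval_counter, hc, h.eval_classesE]
    have h4 := Nat.mod_lt n hM
    constructor
    · simp only [testE, eval_sub, eval_mul, h.eval_classesE, eval_counter, hc]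
      omega
    · simp only [entryE, eval_add, eval_ite, eval_eq_ne_zero]
      rw [h.eval_rank (by decide) _ (by omega), h1, h2]
      simp only [eval_read, eval_sub, eval_counter, hc, eval_const, table]
      exact ite_add_eq_sum_range hM (f := fun i j => if I.rank i = j then i else 0)
        h.entry_eq rfl
  · simp only [testE, eval_sub, eval_mul, h.eval_classesE, eval_counter, hc, len, Nat.sub_self]

theorem Filled.eval_ord (h : I.Filled E s k) (hk : 13 < k) (a : Expr) (ha : a.eval s < I.M) :
    (rowEndE 13 a classesE).eval s = I.ord (a.eval s) := by
  have hM : 0 < I.M := by omega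
  rw [rowEndE, eval_read, eval_add, eval_mul, eval_sub, h.eval_classesE, eval_const,
    h.table_eq 13 (by decide) hk _ (row_end_lt hM ha)]
  simp only [table, row_end_div hM, row_end_mod hM, Nat.sub_add_cancel hM]
  rfl

theorem partialSize_last (t : ℕ) : I.partialSize t I.M = I.sizes t := by
  cases t <;> rfl

theorem nextSize_succ (v i : ℕ) : I.nextSize v (i + 1) = max (I.nextSize v i)
    (max (below v (I.initialMemory 1 i)) (below v (I.initialMemory 2 i))) := by
  rw [nextSize, nextSize, sup_range_succ, max_assoc]

theorem eval_belowE (v c : Expr) : (belowE v c).eval s = below (v.eval s) (c.eval s) := by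
  rw [belowE, eval_ite, eval_const, below]
  simp only [eval_lt_ne_zero]

theorem computes_sizes : I.Computes E 14 := by
  refine ⟨fun s n hn h => ?_, fun s h => ?_⟩ <;>
    have hc : s 114 0 = _ := h.counter_eq
  · have hn' : n < I.rounds * (I.M + 1) := hn
    constructor
    · simp only [testE, eval_sub, eval_mul, h.eval_widthE, h.eval_roundsE (by decide),
        eval_counter, hc]
      omega
    · have h1 : (div (counter 114) widthE).eval s = n / (I.M + 1) := by
        rw [eval_div, eval_counter, hc, h.eval_widthE]
      have h2 : (mod (counter 114) widthE).eval s = n % (I.M + 1) := by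
        rw [eval_mod, eval_counter, hc, h.eval_widthE]
      obtain ⟨t, ht⟩ : ∃ t, n / (I.M + 1) = t := ⟨_, rfl⟩
      obtain ⟨i, hi⟩ : ∃ i, n % (I.M + 1) = i := ⟨_, rfl⟩
      have hni : n = (I.M + 1) * t + i := by rw [← ht, ← hi, Nat.div_add_mod]
      have hiM : i < I.M + 1 := hi ▸ Nat.mod_lt n (Nat.succ_pos _)
      simp only [entryE, eval_ite, eval_max, eval_belowE, h1, h2, h.eval_firstE, table, ht, hi]
      rcases t with _ | t
      · simp [partialSize]
      · have hv : (rowEndE 14 (sub (div (counter 114) widthE) (const 1)) widthE).eval s =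
            I.sizes t := by
          have h3 : t * (I.M + 1) + (I.M + 1 - 1) < n := by
            rw [hni, mul_comm t]
            have : (I.M + 1) * (t + 1) = (I.M + 1) * t + (I.M + 1) := by ring
            omega
          rw [rowEndE, eval_read, eval_add, eval_mul, eval_sub, eval_sub, h1, h.eval_widthE,
            eval_const, ht, Nat.add_sub_cancel, h.entry_eq _ h3]
          simp only [table, row_end_div (Nat.succ_pos I.M), row_end_mod (Nat.succ_pos I.M)]
          exact partialSize_last t
        rw [if_pos (Nat.succ_ne_zero t)]
        simp only [eval_div, eval_const, hv, partialSize]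
        rcases i with _ | i
        · simp [nextSize]
        · rw [if_pos (Nat.succ_ne_zero i), nextSize_succ]
          simp only [eval_read, eval_sub, h2, hi, eval_counter, hc, eval_const,
            Nat.add_sub_cancel, h.input 1 (by decide), h.input 2 (by decide)]
          rw [h.entry_eq _ (by omega)]
          have h4 : n - 1 = (I.M + 1) * (t + 1) + i := by omega
          have h5 : (n - 1) / (I.M + 1) = t + 1 := by
            rw [h4, Nat.mul_add_div (Nat.succ_pos _), Nat.div_eq_of_lt (by omega), add_zero]
          have h6 : (n - 1) % (I.M + 1) = i := by
            rw [h4, Nat.mul_add_mod, Nat.mod_eq_of_lt (by omega)]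
          simp only [table, h5, h6, partialSize]
  · simp only [testE, eval_sub, eval_mul, h.eval_widthE, h.eval_roundsE (by decide),
      eval_counter, hc, len, Nat.sub_self]

theorem Filled.eval_sizes (h : I.Filled E s k) (hk : 14 < k) (t : Expr)
    (ht : t.eval s < I.rounds) : (rowEndE 14 t widthE).eval s = I.sizes (t.eval s) := by
  rw [rowEndE, eval_read, eval_add, eval_mul, eval_sub, h.eval_widthE, eval_const,
    h.table_eq 14 (by decide) hk _ (row_end_lt (Nat.succ_pos _) ht)]
  simp only [table, row_end_div (Nat.succ_pos I.M), row_end_mod (Nat.succ_pos I.M)]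
  exact partialSize_last _

theorem base_sorted : (I.sorted E).base = I.initialMemory 5 0 + 1 := by
  rw [SortedInstance.base, ← targetSum_one]
  rfl

theorem computes_powers : I.Computes E 15 := by
  refine ⟨fun s n hn h => ?_, fun s h => ?_⟩ <;>
    have hc : s 115 0 = _ := h.counter_eq <;>
    simp only [testE, entryE, table, len, eval_sub, eval_add, eval_read, eval_counter, eval_const,
      eval_not, eval_mul, h.eval_widthE, h.eval_firstE, hc]
  · simp only [len] at hn
    refine ⟨by omega, ?_⟩
    rw [← base_sorted (E := E)]
    rcases n with _ | n
    · simp [h.entry_zero 0 le_rfl]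
    · rw [Nat.add_sub_cancel, h.entry_eq _ (Nat.lt_succ_self _), pow_succ]
      simp [table]
  · omega

theorem Filled.power_eq (h : I.Filled E s k) (hk : 15 < k) {i : ℕ} (hi : i ≤ I.M) :
    s 15 i = (I.sorted E).base ^ i :=
  h.table_eq 15 (by decide) hk i (Nat.lt_succ_of_le hi)

theorem Filled.targetSum_eq (h : I.Filled E s k) (hk : 7 < k) {i : ℕ} (hi : i ≤ I.M) :
    s 7 i = I.targetSum (i + 1) :=
  h.table_eq 7 (by decide) hk i (Nat.lt_succ_of_le hi)

theorem Filled.eval_capE (h : I.Filled E s k) (hk : 7 < k) :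
    capE.eval s = (I.sorted E).cap := by
  rw [capE, eval_add, eval_read, h.eval_classesE, eval_const, h.targetSum_eq hk le_rfl]
  rfl

theorem Filled.eval_extendE (h : I.Filled E s k) (hk : 15 < k) (c x j r : Expr)
    (hj : j.eval s < I.M) (hr : 1 ≤ r.eval s) (hrM : r.eval s ≤ I.M) :
    (extendE c x j r).eval s =
      (I.sorted E).extend (c.eval s) (x.eval s) (j.eval s) (r.eval s) := by
  simp only [extendE, eval_ite, eval_and_ne_zero, eval_le_ne_zero, eval_add, eval_sub, eval_div,
    eval_mul, eval_read, h.eval_capE (by omega), h.eval_classesE, eval_const,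
    h.power_eq hk le_rfl, h.power_eq hk hj.le,
    h.targetSum_eq (by omega) (show r.eval s - 1 ≤ I.M by omega), Nat.sub_add_cancel hr]
  rfl

theorem Filled.eval_scaledE (h : I.Filled E s k) (hk : 11 < k) (i x : Expr)
    (hi : i.eval s < I.M) : (scaledE E i x).eval s =
      I.price (i.eval s) * x.eval s * I.M * E / I.maxSingle := by
  simp only [scaledE, eval_div, eval_mul, eval_read, eval_sub, eval_const, h.eval_classesE,
    h.price_eq (by omega) hi, h.maxSingle_eq hk (by omega)]

theorem Filled.eval_addrE (h : I.Filled E s k) (τ a r p : Expr) : (addrE E τ a r p).eval s =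
    I.addr E (τ.eval s) (a.eval s) (r.eval s) (p.eval s) := by
  simp only [addrE, eval_add, eval_mul, h.eval_widthE, h.eval_profitsE, addr]

theorem profits_pos : 0 < I.profits E := Nat.succ_pos _

theorem addr_div_div_div {τ a r p : ℕ} (ha : a ≤ I.M) (hr : r ≤ I.M) (hp : p < I.profits E) :
    I.addr E τ a r p % I.profits E = p ∧ I.addr E τ a r p / I.profits E % (I.M + 1) = r ∧
    I.addr E τ a r p / I.profits E / (I.M + 1) % (I.M + 1) = a ∧
    I.addr E τ a r p / I.profits E / (I.M + 1) / (I.M + 1) = τ := by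
  have key : ∀ {x y w : ℕ}, y < w → (x * w + y) / w = x ∧ (x * w + y) % w = y := by
    intro x y w hy
    rw [mul_comm, Nat.mul_add_div (by omega), Nat.div_eq_of_lt hy, Nat.mul_add_mod,
      Nat.mod_eq_of_lt hy, add_zero]
    exact ⟨rfl, rfl⟩
  unfold addr
  have h1 := key (x := (τ * (I.M + 1) + a) * (I.M + 1) + r) hp
  have h2 := key (x := τ * (I.M + 1) + a) (Nat.lt_succ_of_le hr)
  have h3 := key (x := τ) (Nat.lt_succ_of_le ha)
  rw [h1.1, h2.1, h3.1]
  exact ⟨h1.2, h2.2, h3.2, rfl⟩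

theorem bestAt_addr {τ a r p : ℕ} (ha : a ≤ I.M) (hr : r ≤ I.M) (hp : p < I.profits E) :
    I.bestAt E (I.addr E τ a r p) = (I.sorted E).best τ a r p := by
  obtain ⟨h1, h2, h3, h4⟩ := addr_div_div_div (τ := τ) ha hr hp
  rw [bestAt, h1, h2, h3, h4]

theorem eq_addr (n : ℕ) : n = I.addr E (n / I.profits E / (I.M + 1) / (I.M + 1))
    (n / I.profits E / (I.M + 1) % (I.M + 1)) (n / I.profits E % (I.M + 1))
    (n % I.profits E) := by
  rw [addr, Nat.div_add_mod', Nat.div_add_mod', Nat.div_add_mod']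

theorem addr_lt_mul_keys {τ a r p l : ℕ} (hτ : τ < l) (ha : a ≤ I.M) (hr : r ≤ I.M)
    (hp : p < I.profits E) : I.addr E τ a r p < l * I.keys E := by
  have key : ∀ {x y w z : ℕ}, y < w → x < z → x * w + y < z * w := by
    intro x y w z hy hx
    have := Nat.mul_le_mul_right w (Nat.succ_le_of_lt hx)
    rw [Nat.succ_mul] at this
    omega
  have h := key hp (key (Nat.lt_succ_of_le hr) (key (Nat.lt_succ_of_le ha) hτ))
  rw [addr, keys]
  convert h using 1
  simp only [Nat.succ_eq_add_one]
  ring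

theorem addr_lt_addr {τ τ' a a' r r' p p' : ℕ} (hτ : τ < τ') (ha : a ≤ I.M) (hr : r ≤ I.M)
    (hp : p < I.profits E) : I.addr E τ a r p < I.addr E τ' a' r' p' := by
  refine (addr_lt_mul_keys hτ ha hr hp).trans_le ?_
  rw [addr, keys]
  calc τ' * ((I.M + 1) * (I.M + 1) * I.profits E)
      = (τ' * (I.M + 1)) * (I.M + 1) * I.profits E := by ring
    _ ≤ (τ' * (I.M + 1) + a') * (I.M + 1) * I.profits E := by gcongr; omega
    _ ≤ ((τ' * (I.M + 1) + a') * (I.M + 1) + r') * I.profits E := by gcongr; omega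
    _ ≤ _ := Nat.le_add_right _ _

end GAPInstance

namespace GAPInstance

open Finset RAM RAM.Expr

variable {I : GAPInstance} {E : ℕ} {s : Memory} {k n : ℕ}

theorem Filling.eval_read_addrE (h : I.Filling E s 16 n) {τ' a' r' p' : ℕ}
    (hn : n = I.addr E τ' a' r' p') (τ a r p : Expr) (hτ : τ.eval s < τ') (ha : a.eval s ≤ I.M)
    (hr : r.eval s ≤ I.M) (hp : p.eval s < I.profits E) :
    (read 16 (addrE E τ a r p)).eval s =
      (I.sorted E).best (τ.eval s) (a.eval s) (r.eval s) (p.eval s) := by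
  rw [eval_read, h.eval_addrE, h.entry_eq _ (hn ▸ addr_lt_addr hτ ha hr hp)]
  exact bestAt_addr ha hr hp

/-- The recursion of the dynamic program, evaluated by the machine. -/
theorem Filling.eval_stepE (h : I.Filling E s 16 n) {τ' a' r' p' : ℕ}
    (hn : n = I.addr E τ' a' r' p') (τ a r p j i x : Expr) (hτ : τ.eval s < τ')
    (ha : a.eval s ≤ I.M) (hr : r.eval s ≤ I.M) (hp : p.eval s < I.profits E)
    (hM : 0 < I.M) (hj : j.eval s = τ.eval s % I.M) (hi : i.eval s = I.ord (τ.eval s % I.M))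
    (hx : x.eval s = I.sizes (τ.eval s / I.M)) :
    (stepE E τ a r p j i x).eval s =
      (I.sorted E).best (τ.eval s + 1) (a.eval s) (r.eval s) (p.eval s) := by
  have hjM : τ.eval s % I.M < I.M := Nat.mod_lt _ hM
  have hiM := ord_lt hjM
  have hq := h.eval_scaledE (by decide) i x (by rw [hi]; exact hiM)
  rw [hi, hx] at hq
  rw [SortedInstance.best]
  simp only [stepE, eval_max, eval_ite, eval_and_ne_zero, eval_or_ne_zero, eval_le_ne_zero,
    eval_lt_ne_zero, eval_eq_ne_zero]
  rw [h.eval_read_addrE hn τ a r p hτ ha hr hp,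
    h.eval_read_addrE hn τ j r p hτ (by omega) hr hp]
  congr 1
  · simp only [eval_add, eval_const, hj]
    rfl
  · by_cases hr1 : 1 ≤ r.eval s
    · rw [h.eval_extendE (by decide) _ _ _ _ (by omega) hr1 hr,
        h.eval_extendE (by decide) _ _ _ _ (by omega) hr1 hr,
        h.eval_read_addrE hn τ a _ _ hτ ha (by rw [eval_sub]; omega) (by rw [eval_sub]; omega),
        h.eval_read_addrE hn τ j _ _ hτ (by omega) (by rw [eval_sub]; omega)
          (by rw [eval_sub]; omega)]
      simp only [eval_read, eval_add, eval_sub, eval_const, hj, hi, hx, hq,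
        h.input 1 (by decide), h.input 2 (by decide)]
      rfl
    · simp only [eval_const, hr1, false_and, if_false]

theorem div_keys (n : ℕ) : n / I.profits E / (I.M + 1) / (I.M + 1) = n / I.keys E := by
  rw [Nat.div_div_eq_div_mul, Nat.div_div_eq_div_mul, keys]
  congr 1
  ring

theorem keys_pos : 0 < I.keys E :=
  Nat.mul_pos (Nat.mul_pos (Nat.succ_pos _) (Nat.succ_pos _)) profits_pos

theorem Filled.eval_stepOfE (h : I.Filled E s k) (e : Expr) : (stepOfE E e).eval s =
    e.eval s / I.profits E / (I.M + 1) / (I.M + 1) := by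
  simp only [stepOfE, eval_div, h.eval_widthE, h.eval_profitsE]

theorem computes_best : I.Computes E 16 := by
  refine ⟨fun s n hn h => ?_, fun s h => ?_⟩ <;>
    have hc : (counter 116).eval s = _ := h.counter_eq <;>
    simp only [testE, eval_sub, eval_add, eval_mul, eval_const, h.eval_classesE,
      h.eval_roundsE (by decide), h.eval_keysE, hc]
  · have hn' : n < (I.rounds * I.M + 1) * I.keys E := hn
    refine ⟨by omega, ?_⟩
    have hlt : n / I.profits E / (I.M + 1) / (I.M + 1) < I.rounds * I.M + 1 := by
      rw [div_keys]
      exact Nat.div_lt_of_lt_mul (by rwa [mul_comm])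
    have haddr := eq_addr (I := I) (E := E) n
    have hp : (profitOfE E (counter 116)).eval s = n % I.profits E := by
      simp only [profitOfE, eval_mod, h.eval_profitsE, hc]
    have hr : (countOfE E (counter 116)).eval s = n / I.profits E % (I.M + 1) := by
      simp only [countOfE, eval_mod, eval_div, h.eval_profitsE, h.eval_widthE, hc]
    have ha : (thresholdOfE E (counter 116)).eval s =
        n / I.profits E / (I.M + 1) % (I.M + 1) := by
      simp only [thresholdOfE, eval_mod, eval_div, h.eval_profitsE, h.eval_widthE, hc]
    simp only [entryE, bestE, eval_ite, table, bestAt]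
    rw [h.eval_stepOfE, hc]
    obtain ⟨τ', hτ'⟩ : ∃ τ', n / I.profits E / (I.M + 1) / (I.M + 1) = τ' := ⟨_, rfl⟩
    rw [hτ'] at hlt haddr ⊢
    have hpl := Nat.mod_lt n (profits_pos (I := I) (E := E))
    have hrl : n / I.profits E % (I.M + 1) < I.M + 1 := Nat.mod_lt (n / I.profits E) (Nat.succ_pos I.M)
    have hal : n / I.profits E / (I.M + 1) % (I.M + 1) < I.M + 1 :=
      Nat.mod_lt (n / I.profits E / (I.M + 1)) (Nat.succ_pos I.M)
    rcases τ' with _ | τ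
    · rw [if_neg (by simp), SortedInstance.best, eval_const, eval_mul,
        h.eval_capE (by decide), eval_read, h.eval_classesE, h.power_eq (by decide) le_rfl]
      by_cases hn0 : n = 0
      · simp only [hn0, Nat.zero_div, Nat.zero_mod, ne_eq, not_true_eq_false, if_false, and_self,
          if_true]
        rfl
      · rw [if_pos hn0, if_neg]
        rintro ⟨h1, h2, h3⟩
        rw [h1, h2, h3] at haddr
        simp [addr] at haddr
        exact hn0 haddr
    · have hM : 0 < I.M := Nat.pos_of_ne_zero fun h0 => by simp [h0] at hlt
      have hτ : (sub (stepOfE E (counter 116)) (const 1)).eval s = τ := by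
        rw [eval_sub, h.eval_stepOfE, hc, hτ', eval_const, Nat.add_sub_cancel]
      have hmod : (mod (sub (stepOfE E (counter 116)) (const 1)) classesE).eval s = τ % I.M := by
        rw [eval_mod, hτ, h.eval_classesE]
      have hdiv : (div (sub (stepOfE E (counter 116)) (const 1)) classesE).eval s = τ / I.M := by
        rw [eval_div, hτ, h.eval_classesE]
      have hjM : τ % I.M < I.M := Nat.mod_lt _ hM
      have htT : τ / I.M < I.rounds := Nat.div_lt_of_lt_mul (by rw [mul_comm]; omega)
      rw [if_pos (Nat.succ_ne_zero τ), h.eval_stepE haddr _ _ _ _ _ _ _ (by omega) (by omega)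
        (by omega) (by omega) hM (by rw [hmod, hτ])
        (by rw [h.eval_ord (by decide) _ (by omega), hmod, hτ])
        (by rw [h.eval_sizes (by decide) _ (by omega), hdiv, hτ]), hτ, ha, hr, hp]
  · exact Nat.sub_self _

theorem addr_zero_zero (τ n : ℕ) : I.addr E τ 0 0 n = τ * I.keys E + n := by
  rw [addr, keys]
  ring

theorem computes_candidates : I.Computes E 17 := by
  refine ⟨fun s n hn h => ?_, fun s h => ?_⟩ <;>
    have hc : s 117 0 = _ := h.counter_eq <;>
    simp only [testE, entryE, table, len, eval_sub, eval_max, eval_read, eval_counter, eval_const,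
      h.eval_keysE, hc]
  · have hn' : n < I.keys E := hn
    refine ⟨by omega, ?_⟩
    have hf : (finalE E (counter 117)).eval s =
        I.bestAt E (I.addr E (I.rounds * I.M) 0 0 n) := by
      rw [finalE, eval_read, h.eval_addrE, eval_mul, h.eval_roundsE (by decide),
        h.eval_classesE, eval_const, eval_counter, hc]
      refine h.table_eq 16 (by decide) (by decide) _ ?_
      rw [addr_zero_zero]
      simp only [len]
      rw [Nat.succ_mul]
      omega
    have hcand : (ite (finalE E (counter 117)) (add (mul (mod (counter 117) (profitsE E))
        (mul (add capE (const 1)) (read 15 classesE))) (finalE E (counter 117)))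
        (const 0)).eval s = I.candidate E n := by
      simp only [eval_ite, eval_add, eval_mul, eval_mod, hf, eval_counter, hc, h.eval_profitsE,
        h.eval_capE (by decide), eval_read, h.eval_classesE, h.power_eq (by decide) le_rfl,
        eval_const]
      rfl
    rw [hcand, sup_range_succ]
    rcases n with _ | n
    · simp [h.entry_zero 0 le_rfl]
    · rw [Nat.add_sub_cancel, h.entry_eq _ (Nat.lt_succ_self _)]
      rfl
  · exact Nat.sub_self _

theorem computes_table (hk : 7 ≤ k) (hk' : k < 18) : I.Computes E k := by
  interval_cases k
  exacts [computes_targetSum, computes_halves, computes_denominators, computes_price,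
    computes_maxSingle, computes_precedes, computes_ord, computes_sizes, computes_powers,
    computes_best, computes_candidates]

/-! ### The allocation that is written -/

variable (I E) in
/-- The best final entry, preceded by its scaled profit. -/
def winner : ℕ := (range (I.keys E)).sup (I.candidate E)

/-- The digits of a number that ends in given digits. -/
theorem div_pow_mod_eq {b : ℕ} {z : ℕ → ℕ} (hz : ∀ i, z i < b) {i m : ℕ} (hi : i < m) (c : ℕ) :
    (c * b ^ m + ∑ j ∈ range m, z j * b ^ j) / b ^ i % b = z i := by
  obtain ⟨d, rfl⟩ := Nat.exists_eq_add_of_lt hi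
  induction d generalizing c with
  | zero =>
    have hb : 0 < b ^ i := pow_pos (Nat.zero_lt_of_lt (hz 0)) i
    have h : c * b ^ (i + 0 + 1) + ∑ j ∈ range (i + 0 + 1), z j * b ^ j =
        b ^ i * (b * c + z i) + ∑ j ∈ range i, z j * b ^ j := by
      rw [add_zero, sum_range_succ]
      ring
    rw [h, Nat.mul_add_div hb, Nat.div_eq_of_lt (SortedInstance.sum_mul_pow_lt hz i), add_zero,
      Nat.mul_add_mod, Nat.mod_eq_of_lt (hz i)]
  | succ d ih =>
    have h : c * b ^ (i + (d + 1) + 1) + ∑ j ∈ range (i + (d + 1) + 1), z j * b ^ j =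
        (c * b + z (i + d + 1)) * b ^ (i + d + 1) + ∑ j ∈ range (i + d + 1), z j * b ^ j := by
      rw [show i + (d + 1) + 1 = (i + d + 1) + 1 by ring, sum_range_succ]
      ring
    rw [h, ih _ (by omega)]

theorem code_lt_codeBound {z : ℕ → ℕ} (hz : (I.sorted E).Feas z) :
    (I.sorted E).code z < I.codeBound E := by
  have h1 : (I.sorted E).digits z < (I.sorted E).base ^ I.M := hz.digits_lt
  have h2 := Nat.mul_le_mul_right ((I.sorted E).base ^ I.M)
    (Nat.sub_le (I.sorted E).cap ((I.sorted E).total z))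
  rw [SortedInstance.code, codeBound, Nat.succ_mul]
  exact Nat.add_lt_add_of_le_of_lt h2 h1

theorem exists_bestAt_eq (n : ℕ) (hn : n < I.keys E) : ∃ a r,
    I.bestAt E (I.addr E (I.rounds * I.M) 0 0 n) =
      (I.sorted E).best (I.rounds * I.M) a r (n % I.profits E) := by
  have h1 : I.addr E (I.rounds * I.M) 0 0 n / I.keys E = I.rounds * I.M := by
    rw [addr_zero_zero, mul_comm, Nat.mul_add_div keys_pos, Nat.div_eq_of_lt hn, add_zero]
  have h2 : I.addr E (I.rounds * I.M) 0 0 n % I.profits E = n % I.profits E := by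
    rw [addr, Nat.mul_add_mod']
  rw [bestAt, div_keys, h1, h2]
  exact ⟨_, _, rfl⟩

/-- The digits of the winner are a feasible allocation, which is approximately optimal. -/
theorem exists_feas_digits_winner : ∃ z, (I.sorted E).Feas z ∧
    (∀ i < I.M, I.winner E / (I.sorted E).base ^ i % (I.sorted E).base = z i) ∧
    ∀ y, (I.sorted E).Feas y → E * (I.sorted E).profit y ≤
      2 * E * (I.sorted E).profit z + 2 * (I.sorted E).profit y := by
  obtain ⟨a, r, p, ha, hr, hp, hne, hopt⟩ :=
    SortedInstance.exists_best_ne_zero_and_profit_le (sorted_valid E) (V := I.maxSingle)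
      (fun _ _ => rfl) (fun z hz a ha => price_mul_le_maxSingle E hz ha)
      (exists_maxSingle_le_profit E)
  have hp' : p < I.profits E := Nat.lt_succ_of_le hp
  have hn0 : I.addr E 0 a r p < I.keys E := by
    simpa using addr_lt_mul_keys (l := 1) Nat.zero_lt_one ha hr hp'
  have hmod : I.addr E 0 a r p % I.profits E = p :=
    (addr_div_div_div (τ := 0) ha hr hp').1
  have hc0 : I.candidate E (I.addr E 0 a r p) = p * I.codeBound E +
      (I.sorted E).best (I.rounds * I.M) a r p := by
    have h1 : I.addr E (I.rounds * I.M) 0 0 (I.addr E 0 a r p) =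
        I.addr E (I.rounds * I.M) a r p := by
      simp only [addr]
      ring
    have h2 := bestAt_addr (τ := I.rounds * I.M) ha hr hp'
    rw [candidate, h1, h2, hmod]
    exact if_pos hne
  obtain ⟨n, hn, hwin⟩ := exists_mem_eq_sup (range (I.keys E)) ⟨_, mem_range.2 hn0⟩
    (I.candidate E)
  have hle : I.candidate E (I.addr E 0 a r p) ≤ I.candidate E n := by
    rw [← hwin]
    exact Finset.le_sup (mem_range.2 hn0)
  obtain ⟨a', r', hbest⟩ := exists_bestAt_eq n (mem_range.1 hn)
  have hne' : I.bestAt E (I.addr E (I.rounds * I.M) 0 0 n) ≠ 0 := by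
    intro h0
    have : I.candidate E n = 0 := by rw [candidate, if_neg (by simp [h0])]
    have hne2 : (I.sorted E).best (I.rounds * I.M) a r p ≠ 0 := hne
    omega
  have hcn : I.candidate E n = n % I.profits E * I.codeBound E +
      I.bestAt E (I.addr E (I.rounds * I.M) 0 0 n) := if_pos hne'
  rw [hbest] at hne' hcn
  obtain ⟨z, hz, hcode⟩ := SortedInstance.best_sound (sorted_valid E) I.rounds 0 (Nat.zero_le _)
    a' r' _ hne'
  have hcode' : (I.sorted E).best (I.rounds * I.M) a' r' (n % I.profits E) =
    (I.sorted E).code z := hcode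
  rw [hcode'] at hcn
  have hlt := code_lt_codeBound hz.feas
  have hple : p ≤ n % I.profits E := by
    by_contra hcon
    have := Nat.mul_le_mul_right (I.codeBound E) (Nat.succ_le_of_lt (not_le.1 hcon))
    rw [Nat.succ_mul] at this
    omega
  refine ⟨z, hz.feas, fun i hi => ?_, hopt z hz.feas (by rwa [hz.scaled_eq])⟩
  have hw : I.winner E = (n % I.profits E * ((I.sorted E).cap + 1) +
      ((I.sorted E).cap - (I.sorted E).total z)) * (I.sorted E).base ^ I.M +
      ∑ j ∈ range I.M, z j * (I.sorted E).base ^ j := by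
    rw [winner, hwin, hcn, SortedInstance.code, codeBound, SortedInstance.digits,
      show (I.sorted E).m = I.M from rfl]
    ring
  rw [hw]
  exact div_pow_mod_eq (fun i => Nat.lt_succ_of_le (hz.feas.le_B_one i)) hi _

theorem Filled.eval_outputE (h : I.Filled E s 18) (hc : s 106 0 = n) (hn : n < I.M) :
    (outputE E).eval s =
      I.winner E / (I.sorted E).base ^ I.rank n % (I.sorted E).base := by
  have hcnt : (counter 106).eval s = n := hc
  have h17 : s 17 (I.keys E - 1) = I.winner E := by
    rw [h.table_eq 17 (by decide) (by decide) (I.keys E - 1) (Nat.sub_one_lt keys_pos.ne')]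
    simp only [table, winner]
    rw [Nat.sub_add_cancel keys_pos]
  have hr : (rowEndE 12 (counter 106) classesE).eval s = I.rank n := by
    rw [h.eval_rank (by decide) _ (by omega), hcnt]
  rw [outputE, eval_mod, eval_div, eval_read, eval_read, eval_sub, h.eval_keysE, eval_const, hr,
    eval_add, h.eval_firstE, eval_const, h17, h.power_eq (by decide) (rank_lt hn).le, base_sorted]

end GAPInstance

/-! ### Bit lengths -/

namespace GAPInstance

open Finset RAM RAM.Expr

theorem size_le_self (n : ℕ) : n.size ≤ n := Nat.size_le.2 Nat.lt_two_pow_self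

theorem size_sum_list_le (l : List ℕ) : l.sum.size ≤ (l.map fun n => 1 + n.size).sum := by
  induction l with
  | nil => simp
  | cons a l ih =>
    rw [List.sum_cons, List.map_cons, List.sum_cons]
    have := size_add_le_add_size a l.sum
    omega

theorem size_prod_range_le {f : ℕ → ℕ} {w : ℕ} (hf : ∀ i, (f i).size ≤ w) (n : ℕ) :
    (∏ i ∈ range n, f i).size ≤ n * w + 1 := by
  induction n with
  | zero => simp
  | succ n ih =>
    rw [prod_range_succ, Nat.succ_mul]
    have := size_mul_le_add_size (∏ i ∈ range n, f i) (f n)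
    have := hf n
    omega

theorem size_sup_le {s : Finset ℕ} {f : ℕ → ℕ} {w : ℕ} (hf : ∀ i ∈ s, (f i).size ≤ w) :
    (s.sup f).size ≤ w := by
  rw [Nat.size_le, Finset.sup_lt_iff (by simp)]
  exact fun i hi => Nat.size_le.1 (hf i hi)

variable (I : GAPInstance) (E : ℕ)

theorem input_sum_le {b : ℕ} (hb : b < 6) :
    ((I.input b).map fun n => 1 + n.size).sum ≤ I.inputSize :=
  single_le_sum (f := fun b => ((I.input b).map fun n => 1 + n.size).sum)
    (fun _ _ => Nat.zero_le _) (mem_range.2 hb)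

theorem size_initialMemory_le (b a : ℕ) : (I.initialMemory b a).size ≤ I.inputSize := by
  by_cases hb : b < 6
  · refine le_trans ?_ (I.input_sum_le hb)
    rw [initialMemory, List.getD_eq_getElem?_getD]
    by_cases ha : a < (I.input b).length
    · rw [List.getElem?_eq_getElem ha, Option.getD_some]
      refine le_trans (Nat.le_add_left _ 1) (List.le_sum_of_mem ?_)
      exact List.mem_map_of_mem (f := fun n => 1 + n.size) (List.getElem_mem ha)
    · rw [List.getElem?_eq_none (not_lt.1 ha)]
      simp
  · have : I.input b = [] := by
      match b, hb with
      | 0, hb | 1, hb | 2, hb | 3, hb | 4, hb | 5, hb => exact absurd (by decide) hb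
      | b + 6, _ => rfl
    simp [initialMemory, this]

theorem M_le_inputSize : I.M ≤ I.inputSize := by
  refine le_trans ?_ (I.input_sum_le (b := 1) (by decide))
  have h : ∀ l : List ℕ, l.length ≤ (l.map fun n => 1 + n.size).sum := fun l => by
    induction l with
    | nil => simp
    | cons a l ih =>
      rw [List.length_cons, List.map_cons, List.sum_cons]
      omega
  simpa [input] using h (List.ofFn I.lower)

theorem size_targetSum_le (r : ℕ) : (I.targetSum r).size ≤ I.inputSize := by
  refine le_trans ?_ (I.input_sum_le (b := 5) (by decide))
  refine (Nat.size_le_size ?_).trans (size_sum_list_le (List.ofFn I.target))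
  exact (List.take_sublist _ _).sum_le_sum fun _ _ => Nat.zero_le _

variable {I E}

theorem size_maxSize_le (i : ℕ) : (I.maxSize i).size ≤ I.inputSize := by
  refine (Nat.size_le_size ?_).trans (I.size_initialMemory_le 2 i)
  unfold maxSize
  split_ifs
  · exact min_le_left _ _
  · exact Nat.zero_le _

theorem size_denom_le : I.denom.size ≤ I.inputSize * I.inputSize + 1 :=
  (size_prod_range_le (I.size_initialMemory_le 4) I.M).trans
    (Nat.succ_le_succ (Nat.mul_le_mul_right _ I.M_le_inputSize))

theorem size_price_le (i : ℕ) :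
    (I.price i).size ≤ I.inputSize + (I.inputSize * I.inputSize + 1) :=
  (size_mul_le_add_size _ _).trans (add_le_add (I.size_initialMemory_le 3 i)
    ((Nat.size_le_size (Nat.div_le_self _ _)).trans size_denom_le))

theorem sizes_le (t : ℕ) : I.sizes t ≤ I.initialMemory 5 0 := by
  induction t with
  | zero => exact le_rfl
  | succ t ih => exact ((nextSize_le _ _).trans (Nat.sub_le _ _)).trans ih

theorem partialSize_le (t i : ℕ) : I.partialSize t i ≤ I.initialMemory 5 0 := by
  cases t with
  | zero => exact le_rfl
  | succ t => exact ((nextSize_le _ _).trans (Nat.sub_le _ _)).trans (sizes_le t)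

theorem size_base_pow_le {k : ℕ} (hk : k ≤ I.M) :
    ((I.sorted E).base ^ k).size ≤ I.inputSize * (I.inputSize + 1) + 1 := by
  have h : ((I.sorted E).base).size ≤ I.inputSize + 1 := by
    rw [base_sorted]
    exact (size_add_le_add_size _ _).trans
      (add_le_add (I.size_initialMemory_le 5 0) (by simp))
  have := size_prod_range_le (f := fun _ => (I.sorted E).base) (fun _ => h) k
  rw [prod_const, card_range] at this
  exact this.trans (Nat.succ_le_succ (Nat.mul_le_mul_right _ (hk.trans I.M_le_inputSize)))

theorem size_codeBound_le : (I.codeBound E).size ≤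
    I.inputSize + 2 + (I.inputSize * (I.inputSize + 1) + 1) := by
  refine (size_mul_le_add_size _ _).trans (add_le_add ?_ (size_base_pow_le le_rfl))
  have h1 := I.size_targetSum_le (I.M + 1)
  have h2 := size_add_le_add_size (I.targetSum (I.M + 1)) 2
  have h3 : Nat.size 2 = 2 := by decide
  have h4 : (I.sorted E).cap + 1 = I.targetSum (I.M + 1) + 2 := rfl
  rw [h4]
  omega

theorem best_le_codeBound {τ : ℕ} (hτ : 0 < I.M ∨ τ = 0) (a r p : ℕ) :
    (I.sorted E).best τ a r p ≤ I.codeBound E := by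
  by_contra hcon
  have hsplit : τ = τ / I.M * I.M + τ % I.M := (Nat.div_add_mod' _ _).symm
  have hne : (I.sorted E).best τ a r p ≠ 0 := by omega
  have hj : τ % I.M ≤ I.M := by
    rcases hτ with h | h
    · exact (Nat.mod_lt _ h).le
    · simp [h]
  obtain ⟨z, hz, hc⟩ := SortedInstance.best_sound (sorted_valid E) (τ / I.M) (τ % I.M) hj a r p
    (by change (I.sorted E).best (τ / I.M * I.M + τ % I.M) a r p ≠ 0; rwa [← hsplit])
  change (I.sorted E).best (τ / I.M * I.M + τ % I.M) a r p = _ at hc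
  rw [← hsplit] at hc
  have := code_lt_codeBound hz.feas
  omega

theorem bestAt_le_codeBound {n : ℕ} (hn : n < I.len E 16) : I.bestAt E n ≤ I.codeBound E := by
  refine best_le_codeBound ?_ _ _ _
  rcases Nat.eq_zero_or_pos I.M with h | h
  · right
    rw [div_keys]
    refine Nat.div_eq_of_lt ?_
    simpa [len, h] using hn
  · exact .inl h

theorem size_candidate_le {n : ℕ} (hn : n < I.keys E) : (I.candidate E n).size ≤
    I.profits E + 2 * (I.codeBound E).size := by
  unfold candidate
  split_ifs
  · have h1 : I.bestAt E (I.addr E (I.rounds * I.M) 0 0 n) ≤ I.codeBound E := by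
      refine bestAt_le_codeBound ?_
      rw [addr_zero_zero]
      simp only [len]
      rw [Nat.succ_mul]
      omega
    have h2 := Nat.size_le_size h1
    have h3 := size_add_le_add_size (n % I.profits E * I.codeBound E)
      (I.bestAt E (I.addr E (I.rounds * I.M) 0 0 n))
    have h4 := size_mul_le_add_size (n % I.profits E) (I.codeBound E)
    have h5 := size_le_self (n % I.profits E)
    have h6 := Nat.mod_lt n (profits_pos (I := I) (E := E))
    omega
  · simp

variable (I E) in
/-- A bound on the lengths of the tables and on all bit lengths. -/
def bound : ℕ := (I.inputSize + (E + 4)) ^ 8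

theorem rounds_le : I.rounds ≤ 3 * I.inputSize + 1 := by
  have h1 := I.M_le_inputSize
  have h2 := I.size_initialMemory_le 5 0
  unfold rounds
  omega

theorem profits_le : I.profits E ≤ (I.inputSize + (E + 4)) ^ 3 := by
  set Y := I.inputSize + (E + 4) with hY
  have hM : I.M ≤ Y - 4 := by have := I.M_le_inputSize; omega
  have hE : E ≤ Y - 4 := by omega
  obtain ⟨y, hy⟩ : ∃ y, Y = y + 4 := ⟨Y - 4, by omega⟩
  rw [hy, Nat.add_sub_cancel] at hM hE
  rw [profits, hy]
  calc I.M * I.M * E + 1 ≤ y * y * y + 1 := by gcongr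
    _ ≤ (y + 4) ^ 3 := by ring_nf; omega

theorem keys_le : I.keys E ≤ (I.inputSize + (E + 4)) ^ 5 := by
  have hM : I.M + 1 ≤ I.inputSize + (E + 4) := by have := I.M_le_inputSize; omega
  calc I.keys E ≤ (I.inputSize + (E + 4)) * (I.inputSize + (E + 4)) *
        (I.inputSize + (E + 4)) ^ 3 := by
        rw [keys]
        have := profits_le (I := I) (E := E)
        gcongr
    _ = _ := by ring

theorem rounds_mul_le : I.rounds * (I.M + 1) ≤ (I.inputSize + (E + 4)) ^ 3 := by
  have hM : I.M + 1 ≤ I.inputSize + (E + 4) := by have := I.M_le_inputSize; omega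
  have hr : I.rounds ≤ (I.inputSize + (E + 4)) * (I.inputSize + (E + 4)) := by
    have := rounds_le (I := I)
    nlinarith
  calc I.rounds * (I.M + 1) ≤ (I.inputSize + (E + 4)) * (I.inputSize + (E + 4)) *
        (I.inputSize + (E + 4)) := by gcongr
    _ = _ := by ring

theorem pow_le_bound {j : ℕ} (hj : j ≤ 8) : (I.inputSize + (E + 4)) ^ j ≤ I.bound E :=
  Nat.pow_le_pow_right (by omega) hj

theorem small_le_bound {x : ℕ} (hx : x ≤ 4 * (I.inputSize * I.inputSize) + 4 * I.inputSize + 4) :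
    x ≤ I.bound E := by
  refine le_trans ?_ (pow_le_bound (show 3 ≤ 8 by decide))
  set Y := I.inputSize + (E + 4) with hY
  have h1 : I.inputSize * I.inputSize + I.inputSize + 1 ≤ Y * Y := by nlinarith
  have h2 := Nat.mul_le_mul (show 4 ≤ Y by omega) h1
  have h3 : Y ^ 3 = Y * (Y * Y) := by ring
  omega

theorem M_le_small : I.M * I.M ≤ I.inputSize * I.inputSize :=
  Nat.mul_le_mul I.M_le_inputSize I.M_le_inputSize

theorem inputSize_le_bound : I.inputSize ≤ I.bound E := small_le_bound (by omega)

theorem len_le_bound {k : ℕ} (hk : 7 ≤ k) (hk' : k < 18) : I.len E k ≤ I.bound E := by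
  have hM := I.M_le_inputSize
  have hMM := I.M_le_small
  have hN := I.size_initialMemory_le 5 0
  interval_cases k <;> simp only [len]
  any_goals (refine small_le_bound ?_; omega)
  · exact rounds_mul_le.trans (pow_le_bound (by decide))
  · have h1 : I.rounds * I.M + 1 ≤ (I.inputSize + (E + 4)) ^ 3 := by
      refine le_trans ?_ rounds_mul_le
      have : 1 ≤ I.rounds := by unfold rounds; omega
      rw [Nat.mul_succ]
      omega
    calc _ ≤ (I.inputSize + (E + 4)) ^ 3 * (I.inputSize + (E + 4)) ^ 5 :=
          Nat.mul_le_mul h1 keys_le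
      _ = _ := by rw [← pow_add, bound]
  · exact keys_le.trans (pow_le_bound (by decide))

theorem size_codeBound_le_bound : (I.codeBound E).size ≤ I.bound E :=
  small_le_bound (size_codeBound_le.trans (by rw [Nat.mul_succ]; omega))

theorem size_candidate_le_bound {n : ℕ} (hn : n < I.keys E) :
    (I.candidate E n).size ≤ I.bound E := by
  refine (size_candidate_le hn).trans (le_trans ?_ (pow_le_bound (show 4 ≤ 8 by decide)))
  have h1 := profits_le (I := I) (E := E)
  have h2 := size_codeBound_le (I := I) (E := E)
  set Y := I.inputSize + (E + 4) with hY
  have h3 : 2 * (I.codeBound E).size ≤ Y ^ 3 := by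
    have h4 : (I.codeBound E).size ≤ Y * Y := by nlinarith
    have h5 : Y ^ 3 = Y * (Y * Y) := by ring
    rw [h5]
    exact Nat.mul_le_mul (by omega) h4
  have h6 : Y ^ 4 = Y * Y ^ 3 := by ring
  have h7 := Nat.mul_le_mul_right (Y ^ 3) (show 2 ≤ Y by omega)
  omega

theorem size_table_le_bound {k : ℕ} (hk : 7 ≤ k) (hk' : k < 18) {n : ℕ} (hn : n < I.len E k) :
    (I.table E k n).size ≤ I.bound E := by
  have hM := I.M_le_inputSize
  have hMM := I.M_le_small
  have hN := I.size_initialMemory_le 5 0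
  have hmod : ∀ m, n < m * m → n % m + 1 ≤ m := fun m h =>
    Nat.mod_lt _ (Nat.pos_of_ne_zero fun h0 => by simp [h0] at h)
  interval_cases k <;> simp only [table]
  · exact (I.size_targetSum_le _).trans inputSize_le_bound
  · exact ((Nat.size_le_size (Nat.div_le_self _ _)).trans hN).trans inputSize_le_bound
  · simp only [len] at hn
    refine small_le_bound ((size_prod_range_le (I.size_initialMemory_le 4) n).trans ?_)
    have := Nat.mul_le_mul_right I.inputSize (show n ≤ I.inputSize by omega)
    omega
  · exact small_le_bound ((size_price_le n).trans (by omega))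
  · refine size_sup_le fun i _ => small_le_bound ?_
    have h1 := size_mul_le_add_size (I.price i) (I.maxSize i)
    have h2 := size_price_le (I := I) i
    have h3 := size_maxSize_le (I := I) i
    omega
  · refine small_le_bound ((size_le_self _).trans ?_)
    have h1 := hmod I.M hn
    have h2 := sum_le_card_nsmul (range (n % I.M + 1))
      (fun i => if I.Precedes i (n / I.M) then 1 else 0) 1 fun i _ => by
        split_ifs <;> omega
    rw [card_range, smul_eq_mul, mul_one] at h2
    omega
  · refine small_le_bound ((size_le_self _).trans ?_)
    have h1 := hmod I.M hn
    have h2 := sum_le_card_nsmul (range (n % I.M + 1))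
      (fun j => if I.rank j = n / I.M then j else 0) I.M fun i hi => by
        have := mem_range.1 hi
        split_ifs <;> omega
    rw [card_range, smul_eq_mul] at h2
    have h3 := Nat.mul_le_mul_right I.M h1
    omega
  · exact ((Nat.size_le_size (partialSize_le _ _)).trans hN).trans inputSize_le_bound
  · simp only [len] at hn
    exact small_le_bound ((size_base_pow_le (by omega)).trans (by rw [Nat.mul_succ]; omega))
  · exact (Nat.size_le_size (bestAt_le_codeBound hn)).trans size_codeBound_le_bound
  · simp only [len] at hn
    exact size_sup_le fun i hi => size_candidate_le_bound (by have := mem_range.1 hi; omega)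

/-! ### Running the program -/

variable (I E) in
/-- The memory before the table in bank `k` is filled. -/
structure Stage (s : Memory) (k : ℕ) : Prop extends Filled I E s k where
  fresh : ∀ b, k ≤ b → b < 100 → ∀ a, s b a = 0
  fresh_counter : ∀ b, k ≤ b → b < 100 → s (100 + b) 0 = 0
  output_eq : ∀ a, s 6 a = 0
  output_counter : s 106 0 = 0
  size_le : ∀ b a, (s b a).size ≤ I.bound E

theorem stage_initialMemory : I.Stage E I.initialMemory 7 := by
  have h : ∀ b a, 6 ≤ b → I.initialMemory b a = 0 := by
    intro b a hb
    obtain ⟨c, rfl⟩ := Nat.exists_eq_add_of_le' hb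
    rfl
  exact ⟨⟨fun _ _ => rfl, fun b h1 h2 => by omega, fun b h1 h2 => by omega⟩,
    fun b hb _ a => h b a (by omega), fun b hb _ => h _ 0 (by omega), fun a => h 6 a le_rfl,
    h 106 0 (by decide), fun b a => (I.size_initialMemory_le b a).trans inputSize_le_bound⟩

theorem filled_zero {s : Memory} {b c : ℕ} {f : ℕ → ℕ} (h : s c 0 = 0) : s.filled b c f 0 = s := by
  funext b' a'
  simp only [Memory.filled, Nat.not_lt_zero, and_false, if_false]
  split_ifs with h1
  · rw [h1.1, h1.2, h]
  · rfl

theorem Stage.filling {s : Memory} {k : ℕ} (h : I.Stage E s k) (hk : 7 ≤ k) (hk' : k < 18)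
    (n : ℕ) : I.Filling E (s.filled k (100 + k) (I.table E k) n) k n where
  input b hb := by
    funext a
    simp [Memory.filled, show b ≠ k by omega, show b ≠ 100 + k by omega, h.input b hb]
  table_eq b hb hbk a ha := by
    simp [Memory.filled, show b ≠ k by omega, show b ≠ 100 + k by omega, h.table_eq b hb hbk a ha]
  len_eq b hb hbk := by
    simp [Memory.filled, show 100 + b ≠ k by omega, show b ≠ k by omega, h.len_eq b hb hbk]
  entry_eq a ha := by simp [Memory.filled, ha]
  entry_zero a ha := by
    simp [Memory.filled, show ¬ a < n by omega, h.fresh k le_rfl (by omega) a]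
  counter_eq := by simp [Memory.filled]

theorem one_le_bound : 1 ≤ I.bound E := small_le_bound (by omega)

theorem Stage.exec {s : Memory} {k : ℕ} (h : I.Stage E s k) (hk : 7 ≤ k) (hk' : k < 18) :
    ∃ t s', Exec (fill k (100 + k) (testE E k) (entryE E k)) s t s' ∧
      t ≤ (I.bound E + 1) * (fillWork (100 + k) (testE E k) (entryE E k) * I.bound E) ∧
      I.Stage E s' (k + 1) := by
  obtain ⟨hc, hlast⟩ := computes_table (I := I) (E := E) hk hk'
  have hlen := len_le_bound (I := I) (E := E) hk hk'
  have hlen' := (size_le_self _).trans hlen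
  have htab := fun n hn => size_table_le_bound (I := I) (E := E) hk hk' (n := n) hn
  obtain ⟨t, ht, hle⟩ := exec_fill (s := s) (b := k) (c := 100 + k) (by omega) one_le_bound
    h.size_le htab hlen'
    (fun n hn => (hc _ n hn (h.filling hk hk' n)).1) (hlast _ (h.filling hk hk' _))
    (fun n hn => (hc _ n hn (h.filling hk hk' n)).2)
  rw [filled_zero (h.fresh_counter k le_rfl (by omega))] at ht
  have hf := h.filling hk hk' (I.len E k)
  refine ⟨t, _, ht, hle.trans (Nat.mul_le_mul_right _ (Nat.succ_le_succ hlen)),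
    ⟨⟨hf.input, fun b hb hbk a ha => ?_, fun b hb hbk => ?_⟩, fun b hb hb' a => ?_,
      fun b hb hb' => ?_, fun a => ?_, ?_, fun b a => ?_⟩⟩
  · rcases (Nat.lt_succ_iff_lt_or_eq.1 hbk) with hlt | rfl
    · exact hf.table_eq b hb hlt a ha
    · exact hf.entry_eq a ha
  · rcases (Nat.lt_succ_iff_lt_or_eq.1 hbk) with hlt | rfl
    · exact hf.len_eq b hb hlt
    · exact hf.counter_eq
  · simp [Memory.filled, show b ≠ k by omega, show b ≠ 100 + k by omega,
      h.fresh b (by omega) hb' a]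
  · simp [Memory.filled, show 100 + b ≠ k by omega, show b ≠ k by omega,
      h.fresh_counter b (by omega) hb']
  · simp [Memory.filled, show 6 ≠ k by omega, show 6 ≠ 100 + k by omega, h.output_eq a]
  · simp [Memory.filled, show 106 ≠ k by omega, show 106 ≠ 100 + k by omega, h.output_counter]
  · unfold Memory.filled
    split_ifs with h1 h2
    · exact htab _ h1.2
    · exact hlen'
    · exact h.size_le b a

/-- A factor of the cost of `tablesProgram`. -/
def tablesWork (E : ℕ) : ℕ → ℕ
  | 0 => 1
  | n + 1 => tablesWork E n + fillWork (100 + (7 + n)) (testE E (7 + n)) (entryE E (7 + n))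

theorem exec_tablesProgram (n : ℕ) (hn : n ≤ 11) :
    ∃ t s, Exec (tablesProgram E n) I.initialMemory t s ∧
      t ≤ (I.bound E + 1) * (tablesWork E n * I.bound E) ∧ I.Stage E s (7 + n) := by
  induction n with
  | zero =>
    refine ⟨1, _, Exec.skip _, ?_, stage_initialMemory⟩
    have := one_le_bound (I := I) (E := E)
    simp only [tablesWork]
    nlinarith
  | succ n ih =>
    obtain ⟨t₁, s₁, h₁, hle₁, hs₁⟩ := ih (by omega)
    obtain ⟨t₂, s₂, h₂, hle₂, hs₂⟩ := hs₁.exec (by omega) (by omega)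
    refine ⟨_, s₂, Exec.seq h₁ h₂, ?_, hs₂⟩
    rw [tablesWork, add_mul (tablesWork E n), mul_add (I.bound E + 1)]
    omega

theorem Stage.exec_output {s : Memory} (h : I.Stage E s 18) {z : ℕ → ℕ}
    (hz : ∀ i < I.M, I.winner E / (I.sorted E).base ^ i % (I.sorted E).base = z i) :
    ∃ t s', Exec (fill 6 106 outputTestE (outputE E)) s t s' ∧
      t ≤ (I.bound E + 1) * (fillWork 106 outputTestE (outputE E) * I.bound E) ∧
      I.output s' = I.unsort z := by
  have hf : ∀ n, I.Filled E (s.filled 6 106 (fun i => z (I.rank i)) n) 18 := fun n =>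
    { input := fun b hb => by
        funext a
        simp [Memory.filled, show b ≠ 6 by omega, show b ≠ 106 by omega, h.input b hb]
      table_eq := fun b hb hbk a ha => by
        simp [Memory.filled, show b ≠ 6 by omega, show b ≠ 106 by omega, h.table_eq b hb hbk a ha]
      len_eq := fun b hb hbk => by
        simp [Memory.filled, show 100 + b ≠ 6 by omega, show 100 + b ≠ 106 by omega,
          h.len_eq b hb hbk] }
  have hc : ∀ n, s.filled 6 106 (fun i => z (I.rank i)) n 106 0 = n := fun n => by
    simp [Memory.filled]
  have hM : I.M ≤ I.bound E := I.M_le_inputSize.trans inputSize_le_bound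
  obtain ⟨t, ht, hle⟩ := exec_fill (s := s) (b := 6) (c := 106) (test := outputTestE)
    (e := outputE E) (f := fun i => z (I.rank i)) (len := I.M) (by decide) one_le_bound
    h.size_le (fun n hn => by
      rw [← hz _ (rank_lt hn)]
      refine (Nat.size_le_size ?_).trans
        ((I.size_initialMemory_le 5 0).trans inputSize_le_bound)
      rw [base_sorted]
      exact Nat.le_of_lt_succ (Nat.mod_lt _ (Nat.succ_pos _)))
    ((size_le_self _).trans hM)
    (fun n hn => by
      rw [outputTestE, eval_sub, (hf n).eval_classesE, eval_counter, hc]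
      omega)
    (by rw [outputTestE, eval_sub, (hf _).eval_classesE, eval_counter, hc, Nat.sub_self])
    (fun n hn => by rw [(hf n).eval_outputE (hc n) hn, hz _ (rank_lt hn)])
  rw [filled_zero h.output_counter] at ht
  refine ⟨t, _, ht, hle.trans (Nat.mul_le_mul_right _ (Nat.succ_le_succ hM)), ?_⟩
  funext i
  simp [output, unsort, Memory.filled]

/-- The program writes a feasible allocation that is approximately optimal, at a cost that is
quadratic in `bound`, which is a polynomial in the bit length of the instance. -/
theorem exec_program : ∃ C, ∀ I : GAPInstance, ∃ t s z,
    Exec (program E) I.initialMemory t s ∧ t ≤ C * ((I.bound E + 1) * I.bound E) ∧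
      I.output s = I.unsort z ∧ (I.sorted E).Feas z ∧
      ∀ y, (I.sorted E).Feas y → E * (I.sorted E).profit y ≤
        2 * E * (I.sorted E).profit z + 2 * (I.sorted E).profit y := by
  refine ⟨tablesWork E 11 + fillWork 106 outputTestE (outputE E), fun I => ?_⟩
  obtain ⟨z, hz, hdig, hopt⟩ := exists_feas_digits_winner (I := I) (E := E)
  obtain ⟨t₁, s₁, h₁, hle₁, hs₁⟩ := exec_tablesProgram (I := I) (E := E) 11 le_rfl
  obtain ⟨t₂, s₂, h₂, hle₂, hout⟩ := hs₁.exec_output hdig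
  refine ⟨_, s₂, z, Exec.seq h₁ h₂, (add_le_add hle₁ hle₂).trans (le_of_eq ?_), hout, hz, hopt⟩
  ring

end GAPInstance

theorem mainTheorem3 (ε : ℝ) (hε : 0 < ε) :
    ∃ P : RAM.Program, GAPInstance.IsPolyTimeApproximation (1 / 2 - ε) P := by
  obtain ⟨E, hE⟩ := exists_nat_gt (1 / ε)
  have hE0 : (0 : ℝ) < E := (by positivity : (0 : ℝ) < 1 / ε).trans hE
  obtain ⟨C, hC⟩ := GAPInstance.exec_program (E := E)
  let Y : Polynomial ℕ := (Polynomial.X + Polynomial.C (E + 4)) ^ 8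
  refine ⟨GAPInstance.program E, Polynomial.C C * ((Y + 1) * Y), fun I => ?_⟩
  obtain ⟨t, s, z, hexec, ht, hout, hz, hopt⟩ := hC I
  refine ⟨t, s, hexec, ?_, ?_, fun y hy => ?_⟩
  · simpa [Y, GAPInstance.bound] using ht
  · rw [hout]
    exact (GAPInstance.feasible_unsort_iff E hz.zero).2 hz
  · obtain ⟨x, hx, rfl⟩ := GAPInstance.exists_unsort_eq y
    have h1 := hopt x ((GAPInstance.feasible_unsort_iff E hx).1 hy)
    have h2 : (E : ℝ) * (I.sorted E).profit x ≤
        2 * E * (I.sorted E).profit z + 2 * (I.sorted E).profit x := by exact_mod_cast h1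
    have hp : ∀ w, ((I.sorted E).profit w : ℝ) = (I.totalProfit (I.unsort w) : ℝ) * I.denom :=
      fun w => by exact_mod_cast congrArg (NNRat.cast (K := ℝ)) (GAPInstance.profit_sorted E w)
    rw [hp, hp] at h2
    have hd : (0 : ℝ) < I.denom := by exact_mod_cast GAPInstance.denom_pos
    rw [hout]
    set p : ℝ := (I.totalProfit (I.unsort x) : ℝ)
    set o : ℝ := (I.totalProfit (I.unsort z) : ℝ)
    have hp0 : 0 ≤ p := by positivity
    have h3 : E * p ≤ 2 * E * o + 2 * p := by
      refine le_of_mul_le_mul_right ?_ hd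
      linarith
    have h4 : 1 < E * ε := by
      rw [div_lt_iff₀ hε] at hE
      exact hE
    refine le_of_mul_le_mul_left ?_ hE0
    nlinarith
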